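/- **Variable time search with unknown times.** Let $n, d \ge 1$. An input consists of bits $x_1,\dots,x_n\in\{0,1\}$ and procedures $A_1,\dots,A_n$, where $A_i$ computes $x_i$ in $t_i\ge 1$ steps. Each step is a unitary on a workspace $\mathbb C^d$ (a classical step maps a basis state to a basis state). Let $|v_{i,s}\rangle$ be the content of the workspace after $s$ steps of $A_i$, with $|v_{i,0}\rangle=|0\rangle$. Put $T=\sum_i t_i^2$ and $t_{\max}=\max_i t_i$. An algorithm knows $n$, $d$ and two natural numbers $T'$, $t'$, but not the times $t_i$. It accesses the input only through three unitary oracles, where the step counter ranges over $0,\dots,t'$ and the oracles are arbitrary outside the states listed: - the step oracle $|i\rangle|v_{i,s}\rangle|s\rangle\mapsto|i\rangle|v_{i,s+1}\rangle|s+1\rangle$ for $s<t_i$; - the termination oracle $|i\rangle|v_{i,s}\rangle|s\rangle|0\rangle\mapsto|i\rangle|v_{i,s}\rangle|s\rangle|\mathbb 1[s\ge t_i]\rangle$ for $s\le t_i$; - the output oracle $|v_{i,t_i}\rangle|0\rangle\mapsto|v_{i,t_i}\rangle|x_i\rangle$. A quantum query algorithm alternates unitaries that do not depend on the input with controlled calls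 to these oracles or their inverses, and ends with a measurement. Its number of queries is the total number of calls to all three oracles and their inverses (so in particular it bounds the number of queries to steps of the procedures). **Theorem.** There is a family of quantum query algorithms, one for each choice of $n,d,T',t'$, such that: 1. For every input with $T\le T'$ and $t_{\max}\le t'$, and all oracles as above, the algorithm detects whether there is a $j$ with $x_j=1$: it accepts with probability at least $2/3$ if such a $j$ exists, and with probability at most $1/3$ otherwise. 2. If $T\le T'=O(T)$ and $t_{\max}\le t'=\mathrm{poly}(t_{\max})$, the number of queries is $O\bigl(\sqrt{T\log(t_{\max}+1)}\bigr)$. Precisely: for all real $a,c$ and all $k\in\mathbb N$ there is a constant $C$ such that for all $n,d,T',t'$ and all inputs with $T\le T'\le aT$ and $t_{\max}\le t'\le c\,t_{\max}^{k}$, the number of queries is at most $C\sqrt{T\log(t_{\max}+1)}$. -/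

import Mathlib

/-- An exact (classical or quantum) procedure of positive running time `time` on a workspace with
orthonormal basis `Fin d`: step number `s` is the unitary `step s` (only the steps
`s < time` matter). A deterministic classical step is one that sends a basis state to a
basis state. -/
structure Procedure (d : ℕ) where
  time : ℕ
  time_pos : 0 < time
  step : ℕ → Matrix.unitaryGroup (Fin d) ℂ

/-- The content of the workspace after `s` steps, started in the basis state `0`. -/
noncomputable def Procedure.state {d : ℕ} [NeZero d] (P : Procedure d) : ℕ → (Fin d → ℂ)
  | 0 => Pi.single 0 1
  | s + 1 => Matrix.mulVec (P.step s : Matrix (Fin d) (Fin d) ℂ) (P.state s)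

/-- An input of variable time search: bits `x i` and the procedures `proc i` computing them.
That `proc i` computes `x i` is expressed by the oracle `mark` in `VTSInput.Oracles`, which reads
`x i` off the final content of the workspace. -/
structure VTSInput (n d : ℕ) where
  proc : Fin n → Procedure d
  x : Fin n → Bool

namespace VTSInput

variable {n d : ℕ}

/-- The number of steps of the `i`-th procedure. -/
def time (I : VTSInput n d) (i : Fin n) : ℕ := (I.proc i).time

/-- The sum of the squares of the running times. -/
def sumSq (I : VTSInput n d) : ℕ := ∑ i, I.time i ^ 2

/-- The largest running time. -/
def maxTime (I : VTSInput n d) : ℕ := Finset.univ.sup I.time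

end VTSInput

/-- Basis of the registers read by a step: index, workspace, step counter. -/
abbrev StepReg (n d τ : ℕ) : Type := Fin n × Fin d × Fin (τ + 1)

/-- The state `|i⟩ ⊗ φ ⊗ |s⟩`. -/
def stepState {n d τ : ℕ} (i : Fin n) (φ : Fin d → ℂ) (s : Fin (τ + 1)) :
    StepReg n d τ → ℂ :=
  fun y => if y.1 = i ∧ y.2.2 = s then φ y.2.1 else 0

/-- The state `ψ ⊗ |b⟩`. -/
def withFlag {ι : Type} (ψ : ι → ℂ) (b : Bool) : ι × Bool → ℂ :=
  fun y => if y.2 = b then ψ y.1 else 0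

/-- Unitary oracles giving access to the procedures of an input, with a step counter that runs over
`0, …, τ`. They are constrained only on the states reached by the procedures:

* `step`: `|i⟩ |v_s⟩ |s⟩ ↦ |i⟩ |v_{s+1}⟩ |s+1⟩` for `s < t_i`;
* `done`: `|i⟩ |v_s⟩ |s⟩ |0⟩ ↦ |i⟩ |v_s⟩ |s⟩ |1[s ≥ t_i]⟩` for `s ≤ t_i`;
* `mark`: `|v⟩ |0⟩ ↦ |v⟩ |x_i⟩` for the final content `v` of the workspace of procedure `i`;

here `v_s` is the content of the workspace after `s` steps of procedure `i`. -/
structure VTSInput.Oracles {n d : ℕ} [NeZero d] (I : VTSInput n d) (τ : ℕ) where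
  step : Matrix.unitaryGroup (StepReg n d τ) ℂ
  done : Matrix.unitaryGroup (StepReg n d τ × Bool) ℂ
  mark : Matrix.unitaryGroup (Fin d × Bool) ℂ
  step_spec : ∀ (i : Fin n) (s : Fin τ), (s : ℕ) < I.time i →
    Matrix.mulVec (step : Matrix (StepReg n d τ) (StepReg n d τ) ℂ)
        (stepState i ((I.proc i).state s) s.castSucc) =
      stepState i ((I.proc i).state (s + 1)) s.succ
  done_spec : ∀ (i : Fin n) (s : Fin (τ + 1)), (s : ℕ) ≤ I.time i →
    Matrix.mulVec (done : Matrix (StepReg n d τ × Bool) (StepReg n d τ × Bool) ℂ)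
        (withFlag (stepState i ((I.proc i).state s) s) false) =
      withFlag (stepState i ((I.proc i).state s) s) (decide (I.time i ≤ (s : ℕ)))
  mark_spec : ∀ i : Fin n,
    Matrix.mulVec (mark : Matrix (Fin d × Bool) (Fin d × Bool) ℂ)
        (withFlag ((I.proc i).state (I.time i)) false) =
      withFlag ((I.proc i).state (I.time i)) (I.x i)

/-- The possible queries: an oracle or its inverse. Every query is controlled. -/
inductive Query
  | step | stepInv | done | doneInv | mark | markInv

/-- Basis of the whole memory of an algorithm: control bit, index, workspace, step counter, flag
bit, and further memory of dimension `m + 1`. -/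
abbrev Memory (n d τ m : ℕ) : Type :=
  Bool × Fin n × Fin d × Fin (τ + 1) × Bool × Fin (m + 1)

section Apply

variable {n d τ m : ℕ}

/-- Apply `U` to the index, workspace and counter registers if the control bit is set. -/
noncomputable def applyStep (U : Matrix.unitaryGroup (StepReg n d τ) ℂ)
    (ψ : Memory n d τ m → ℂ) : Memory n d τ m → ℂ
  | (c, i, w, s, b, z) =>
    if c then ∑ y : StepReg n d τ,
      (U : Matrix (StepReg n d τ) (StepReg n d τ) ℂ) (i, w, s) y * ψ (c, y.1, y.2.1, y.2.2, b, z)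
    else ψ (c, i, w, s, b, z)

/-- Apply `U` to the index, workspace, counter and flag registers if the control bit is set. -/
noncomputable def applyDone (U : Matrix.unitaryGroup (StepReg n d τ × Bool) ℂ)
    (ψ : Memory n d τ m → ℂ) : Memory n d τ m → ℂ
  | (c, i, w, s, b, z) =>
    if c then ∑ y : StepReg n d τ × Bool,
      (U : Matrix (StepReg n d τ × Bool) (StepReg n d τ × Bool) ℂ) ((i, w, s), b) y *
        ψ (c, y.1.1, y.1.2.1, y.1.2.2, y.2, z)
    else ψ (c, i, w, s, b, z)

/-- Apply `U` to the workspace and flag registers if the control bit is set. -/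
noncomputable def applyMark (U : Matrix.unitaryGroup (Fin d × Bool) ℂ)
    (ψ : Memory n d τ m → ℂ) : Memory n d τ m → ℂ
  | (c, i, w, s, b, z) =>
    if c then ∑ y : Fin d × Bool,
      (U : Matrix (Fin d × Bool) (Fin d × Bool) ℂ) (w, b) y * ψ (c, i, y.1, s, y.2, z)
    else ψ (c, i, w, s, b, z)

/-- The action of a query on the memory. -/
noncomputable def VTSInput.Oracles.apply [NeZero d] {I : VTSInput n d} (O : I.Oracles τ)
    (q : Query) (ψ : Memory n d τ m → ℂ) : Memory n d τ m → ℂ :=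
  match q with
  | .step => applyStep O.step ψ
  | .stepInv => applyStep O.step⁻¹ ψ
  | .done => applyDone O.done ψ
  | .doneInv => applyDone O.done⁻¹ ψ
  | .mark => applyMark O.mark ψ
  | .markInv => applyMark O.mark⁻¹ ψ

end Apply

/-- A quantum query algorithm: a first unitary, then a list of rounds, each of them a query
followed by a unitary that does not depend on the input, and finally a measurement of the memory in
the computational basis, after which the algorithm accepts if the outcome lies in `accept`. -/
structure QueryAlgorithm (n d τ : ℕ) where
  anc : ℕ
  first : Matrix.unitaryGroup (Memory n d τ anc) ℂ
  rounds : List (Query × Matrix.unitaryGroup (Memory n d τ anc) ℂ)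
  accept : Finset (Memory n d τ anc)

namespace QueryAlgorithm

variable {n d τ : ℕ}

/-- The number of queries; calls to each of the oracles and to their inverses are counted. -/
def numQueries (𝒜 : QueryAlgorithm n d τ) : ℕ := 𝒜.rounds.length

/-- The state before the measurement, started in the all-zero basis state. -/
noncomputable def finalState [NeZero n] [NeZero d] (𝒜 : QueryAlgorithm n d τ)
    {I : VTSInput n d} (O : I.Oracles τ) : Memory n d τ 𝒜.anc → ℂ :=
  𝒜.rounds.foldl
    (fun ψ r => Matrix.mulVec
      (r.2 : Matrix (Memory n d τ 𝒜.anc) (Memory n d τ 𝒜.anc) ℂ) (O.apply r.1 ψ))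
    (Matrix.mulVec (𝒜.first : Matrix (Memory n d τ 𝒜.anc) (Memory n d τ 𝒜.anc) ℂ)
      (Pi.single (false, 0, 0, 0, false, 0) 1))

/-- The probability that the algorithm accepts. -/
noncomputable def acceptProb [NeZero n] [NeZero d] (𝒜 : QueryAlgorithm n d τ)
    {I : VTSInput n d} (O : I.Oracles τ) : ℝ :=
  ∑ y ∈ 𝒜.accept, ‖𝒜.finalState O y‖ ^ 2

/-- The algorithm decides, with error probability at most `1/3`, whether some bit is `1`. -/
def Detects [NeZero n] [NeZero d] (𝒜 : QueryAlgorithm n d τ)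
    {I : VTSInput n d} (O : I.Oracles τ) : Prop :=
  ((∃ j, I.x j = true) → 2 / 3 ≤ 𝒜.acceptProb O) ∧
  ((¬ ∃ j, I.x j = true) → 𝒜.acceptProb O ≤ 1 / 3)

end QueryAlgorithm

/-! The procedures are glued into a tree: `n` paths leave a common root, and vertex `s` of path `i`
carries the workspace after `s` steps. Edge `s`, joining vertices `s` and `s + 1`, gets weight `s +
1`. A path of length `t_i` then has total weight at most `t_i²`, so the tree has weight at most `T`,
while the resistance from the root to the end of a path is a harmonic sum, at most `R = 1 + log t'`.
An electric-network walk decides with about `√(T R)` iterations whether some end is marked. The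
times need not be known: the coin at a vertex uses only the counter and the answers of the
termination and output oracles.

One iteration attaches a clock slot `j` to the root by an edge of weight `r²`. If no end is marked,
the constant potential is a vector `Ω` with `r|j⟩ + Ω ↦ -r|j⟩ + Ω` (`walk_potential`) and `‖Ω‖² ≤
4T`. If an end is marked, the flow to it is an `Ω` with `|j⟩ + Ω ↦ |j⟩ + Ω` (`walk_flow`) and `‖Ω‖²
≤ 4r²R`.

This sign `ε = ∓1` is read off without phase estimation. Each of `K` iterations uses its own slot,
ignores the others and returns `Ω`, so a single `Ω` is a catalyst for the uniform superposition of
all slots (`runCircuit_flatMap_of_mem`). After normalisation its norm is `‖Ω‖ / (c√K)` with `c = r`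
or `c = 1`, so omitting it costs little (`norm_inner_return_sub_le`). Interference with a reference
slot that is never attached turns `ε` into the return amplitude `(1 + ε) / 2`. The choice `r² =
√(T/R)` balances the two cases, and `K = O(√(T R))` suffices. -/

set_option linter.unusedSectionVars false

/-- The Hilbert space spanned by a finite set of basis states. -/
abbrev Amplitudes (ι : Type) : Type := EuclideanSpace ℂ ι

/-! ### Isometries and unitary matrices -/

section Isometries

variable {ι κ ρ : Type} [Fintype ι] [DecidableEq ι] [Fintype κ] [DecidableEq κ] [Fintype ρ]

/-- The unitary matrix of a linear isometric equivalence. -/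
noncomputable def isometryMatrix (L : Amplitudes ι ≃ₗᵢ[ℂ] Amplitudes ι) :
    Matrix.unitaryGroup ι ℂ :=
  ⟨LinearMap.toMatrix (EuclideanSpace.basisFun ι ℂ).toBasis (EuclideanSpace.basisFun ι ℂ).toBasis
      L.toLinearEquiv.toLinearMap, L.toMatrix_mem_unitaryGroup _ _⟩

theorem isometryMatrix_mulVec (L : Amplitudes ι ≃ₗᵢ[ℂ] Amplitudes ι) (ψ : Amplitudes ι) :
    Matrix.mulVec (isometryMatrix L : Matrix ι ι ℂ) ψ.ofLp = (L ψ).ofLp := by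
  have h := LinearMap.toMatrix_mulVec_repr (EuclideanSpace.basisFun ι ℂ).toBasis
    (EuclideanSpace.basisFun ι ℂ).toBasis L.toLinearEquiv.toLinearMap ψ
  have hr : ∀ v : Amplitudes ι, ((EuclideanSpace.basisFun ι ℂ).toBasis.repr v : ι → ℂ) = v.ofLp := by
    intro v; ext i; simp
  rw [hr, hr] at h
  exact h

/-- A unit vector extends to an orthonormal basis, and a change of basis is isometric. This prepares
the start of the walk independently of the input. -/
theorem exists_isometry_single_eq (i : ι) (v : Amplitudes ι) (hv : ‖v‖ = 1) :
    ∃ L : Amplitudes ι ≃ₗᵢ[ℂ] Amplitudes ι, L (EuclideanSpace.single i 1) = v := by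
  have ho : Orthonormal ℂ (Set.domRestrict {i} (fun _ : ι => v)) := by
    constructor
    · exact fun _ => hv
    · intro x y hxy; exact absurd (Subsingleton.elim x y) hxy
  obtain ⟨b, hb⟩ := ho.exists_orthonormalBasis_extension_of_card_eq (by simp)
  refine ⟨(EuclideanSpace.basisFun ι ℂ).equiv b (Equiv.refl ι), ?_⟩
  rw [← EuclideanSpace.basisFun_apply, OrthonormalBasis.equiv_apply_basis]
  exact hb i rfl

/-- The isometry that permutes the basis states by an involution. -/
noncomputable def involutionIsometry (f : ι → ι) (hf : Function.Involutive f) :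
    Amplitudes ι ≃ₗᵢ[ℂ] Amplitudes ι :=
  LinearIsometryEquiv.piLpCongrLeft 2 ℂ ℂ hf.toPerm

theorem involutionIsometry_apply {f : ι → ι} (hf : Function.Involutive f) (ψ : Amplitudes ι)
    (y : ι) : involutionIsometry f hf ψ y = ψ (f y) := rfl

theorem sum_norm_sq_unitary_mulVec (U : Matrix.unitaryGroup ι ℂ) (f : ι → ℂ) :
    ∑ a, ‖Matrix.mulVec (U : Matrix ι ι ℂ) f a‖ ^ 2 = ∑ a, ‖f a‖ ^ 2 := by
  have key : ∀ g : ι → ℂ, ((∑ a, ‖g a‖ ^ 2 : ℝ) : ℂ) = dotProduct (star g) g := by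
    intro g
    simp [dotProduct, Complex.conj_mul']
  have h : dotProduct (star (Matrix.mulVec (U : Matrix ι ι ℂ) f))
      (Matrix.mulVec (U : Matrix ι ι ℂ) f) = dotProduct (star f) f := by
    rw [Matrix.star_mulVec, Matrix.dotProduct_mulVec, Matrix.vecMul_vecMul,
      ← Matrix.star_eq_conjTranspose, Matrix.UnitaryGroup.star_mul_self U, Matrix.vecMul_one]
  rw [← key, ← key] at h
  exact_mod_cast h

/-- Apply `U` to a tensor factor `κ` if the control bit is set. -/
noncomputable def ctrlApply (σ : ι ≃ Bool × κ × ρ) (U : Matrix.unitaryGroup κ ℂ) (ψ : ι → ℂ) :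
    ι → ℂ := fun y =>
  if (σ y).1 then Matrix.mulVec (U : Matrix κ κ ℂ)
    (fun a => ψ (σ.symm ((σ y).1, a, (σ y).2.2))) (σ y).2.1
  else ψ y

theorem ctrlApply_mul (σ : ι ≃ Bool × κ × ρ) (U V : Matrix.unitaryGroup κ ℂ) (ψ : ι → ℂ) :
    ctrlApply σ U (ctrlApply σ V ψ) = ctrlApply σ (U * V) ψ := by
  funext y
  by_cases h : (σ y).1 = true
  · simp [ctrlApply, h, ← Matrix.mulVec_mulVec]
  · simp [ctrlApply, h]

theorem ctrlApply_one (σ : ι ≃ Bool × κ × ρ) (ψ : ι → ℂ) : ctrlApply σ 1 ψ = ψ := by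
  funext y
  by_cases h : (σ y).1 = true
  · have : σ.symm (true, (σ y).2.1, (σ y).2.2) = y := by rw [← h]; simp
    simp [ctrlApply, h, this]
  · simp [ctrlApply, h]

theorem sum_norm_sq_ctrlApply (σ : ι ≃ Bool × κ × ρ) (U : Matrix.unitaryGroup κ ℂ) (ψ : ι → ℂ) :
    ∑ y, ‖ctrlApply σ U ψ y‖ ^ 2 = ∑ y, ‖ψ y‖ ^ 2 := by
  rw [← σ.symm.sum_comp, ← σ.symm.sum_comp (fun y => ‖ψ y‖ ^ 2)]
  simp only [Fintype.sum_prod_type, Fintype.sum_bool, ctrlApply, Equiv.apply_symm_apply]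
  congr 1
  simp only [if_true]
  rw [Finset.sum_comm, Finset.sum_comm (f := fun x y => ‖ψ (σ.symm (true, x, y))‖ ^ 2)]
  exact Finset.sum_congr rfl fun r _ =>
    sum_norm_sq_unitary_mulVec U (fun a => ψ (σ.symm (true, a, r)))

/-- `ctrlApply` as a linear isometry. -/
noncomputable def ctrlIsometry (σ : ι ≃ Bool × κ × ρ) (U : Matrix.unitaryGroup κ ℂ) :
    Amplitudes ι →ₗᵢ[ℂ] Amplitudes ι where
  toFun ψ := WithLp.toLp 2 (ctrlApply σ U ψ.ofLp)
  map_add' ψ φ := by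
    ext y
    by_cases h : (σ y).1 = true
    · simp only [ctrlApply, h, if_true, PiLp.add_apply]
      exact congrFun (Matrix.mulVec_add (U : Matrix κ κ ℂ)
        (fun a => ψ (σ.symm (true, a, (σ y).2.2))) (fun a => φ (σ.symm (true, a, (σ y).2.2)))) _
    · simp [ctrlApply, h]
  map_smul' r ψ := by
    ext y
    by_cases h : (σ y).1 = true
    · simp only [ctrlApply, h, if_true, PiLp.smul_apply, RingHom.id_apply]
      exact congrFun (Matrix.mulVec_smul (U : Matrix κ κ ℂ) r
        (fun a => ψ (σ.symm (true, a, (σ y).2.2)))) _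
    · simp [ctrlApply, h]
  norm_map' ψ := by
    rw [EuclideanSpace.norm_eq, EuclideanSpace.norm_eq]
    exact congrArg Real.sqrt (sum_norm_sq_ctrlApply σ U ψ.ofLp)

end Isometries

/-! ### Queries as isometries -/

section Queries

variable {n d τ m : ℕ}

/-- The memory split into control bit, registers read by a step, and the rest. -/
def stepSplit (n d τ m : ℕ) : Memory n d τ m ≃ Bool × StepReg n d τ × (Bool × Fin (m + 1)) where
  toFun y := (y.1, (y.2.1, y.2.2.1, y.2.2.2.1), y.2.2.2.2)
  invFun y := (y.1, y.2.1.1, y.2.1.2.1, y.2.1.2.2, y.2.2)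
  left_inv _ := rfl
  right_inv _ := rfl

/-- The memory split into control bit, registers of the termination oracle, and the rest. -/
def doneSplit (n d τ m : ℕ) : Memory n d τ m ≃ Bool × (StepReg n d τ × Bool) × Fin (m + 1) where
  toFun y := (y.1, ((y.2.1, y.2.2.1, y.2.2.2.1), y.2.2.2.2.1), y.2.2.2.2.2)
  invFun y := (y.1, y.2.1.1.1, y.2.1.1.2.1, y.2.1.1.2.2, y.2.1.2, y.2.2)
  left_inv _ := rfl
  right_inv _ := rfl

/-- The memory split into control bit, registers of the output oracle, and the rest. -/
def markSplit (n d τ m : ℕ) :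
    Memory n d τ m ≃ Bool × (Fin d × Bool) × (Fin n × Fin (τ + 1) × Fin (m + 1)) where
  toFun y := (y.1, (y.2.2.1, y.2.2.2.2.1), y.2.1, y.2.2.2.1, y.2.2.2.2.2)
  invFun y := (y.1, y.2.2.1, y.2.1.1, y.2.2.2.1, y.2.1.2, y.2.2.2.2)
  left_inv _ := rfl
  right_inv _ := rfl

theorem applyStep_eq (U : Matrix.unitaryGroup (StepReg n d τ) ℂ) (ψ : Memory n d τ m → ℂ) :
    applyStep U ψ = ctrlApply (stepSplit n d τ m) U ψ := rfl

theorem applyDone_eq (U : Matrix.unitaryGroup (StepReg n d τ × Bool) ℂ)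
    (ψ : Memory n d τ m → ℂ) : applyDone U ψ = ctrlApply (doneSplit n d τ m) U ψ := rfl

theorem applyMark_eq (U : Matrix.unitaryGroup (Fin d × Bool) ℂ) (ψ : Memory n d τ m → ℂ) :
    applyMark U ψ = ctrlApply (markSplit n d τ m) U ψ := rfl

/-- The inverse query. -/
def Query.inv : Query → Query
  | .step => .stepInv
  | .stepInv => .step
  | .done => .doneInv
  | .doneInv => .done
  | .mark => .markInv
  | .markInv => .mark

variable [NeZero d] {I : VTSInput n d}

/-- The action of a query as a linear isometry. -/
noncomputable def VTSInput.Oracles.isometry (O : I.Oracles τ) (m : ℕ) :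
    Query → Amplitudes (Memory n d τ m) →ₗᵢ[ℂ] Amplitudes (Memory n d τ m)
  | .step => ctrlIsometry (stepSplit n d τ m) O.step
  | .stepInv => ctrlIsometry (stepSplit n d τ m) O.step⁻¹
  | .done => ctrlIsometry (doneSplit n d τ m) O.done
  | .doneInv => ctrlIsometry (doneSplit n d τ m) O.done⁻¹
  | .mark => ctrlIsometry (markSplit n d τ m) O.mark
  | .markInv => ctrlIsometry (markSplit n d τ m) O.mark⁻¹

theorem VTSInput.Oracles.isometry_apply (O : I.Oracles τ) (q : Query)
    (ψ : Amplitudes (Memory n d τ m)) :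
    O.isometry m q ψ = WithLp.toLp 2 (O.apply q ψ.ofLp) := by
  cases q <;> rfl

theorem VTSInput.Oracles.isometry_inv_apply (O : I.Oracles τ) (q : Query)
    (ψ : Amplitudes (Memory n d τ m)) : O.isometry m q.inv (O.isometry m q ψ) = ψ := by
  cases q <;>
    simp [VTSInput.Oracles.isometry_apply, VTSInput.Oracles.apply, Query.inv, applyStep_eq,
      applyDone_eq, applyMark_eq, ctrlApply_mul, ctrlApply_one]

end Queries

/-! ### Circuits -/

section Circuits

variable {n d τ m : ℕ}

/-- Add a predicate of the further memory to the control bit. -/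
def toggleCtrl (n d τ : ℕ) (p : Fin (m + 1) → Bool) (y : Memory n d τ m) : Memory n d τ m :=
  (xor y.1 (p y.2.2.2.2.2), y.2)

theorem toggleCtrl_involutive (n d τ : ℕ) (p : Fin (m + 1) → Bool) :
    Function.Involutive (toggleCtrl n d τ p) := by
  rintro ⟨c, y⟩
  simp [toggleCtrl]

/-- A stage of a circuit: a query controlled by a predicate of the further memory, followed by an
isometry. -/
structure Stage (n d τ m : ℕ) where
  ctrl : Fin (m + 1) → Bool
  query : Query
  post : Amplitudes (Memory n d τ m) ≃ₗᵢ[ℂ] Amplitudes (Memory n d τ m)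

/-- The isometry that sets the control bit for a stage. -/
noncomputable def Stage.toggle (σ : Stage n d τ m) :
    Amplitudes (Memory n d τ m) ≃ₗᵢ[ℂ] Amplitudes (Memory n d τ m) :=
  involutionIsometry _ (toggleCtrl_involutive n d τ σ.ctrl)

/-- The isometry to apply before the first query of a circuit that ends with `last`. -/
noncomputable def circuitHead
    (last : Amplitudes (Memory n d τ m) ≃ₗᵢ[ℂ] Amplitudes (Memory n d τ m)) :
    List (Stage n d τ m) → Amplitudes (Memory n d τ m) ≃ₗᵢ[ℂ] Amplitudes (Memory n d τ m)
  | [] => last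
  | σ :: _ => σ.toggle

/-- The rounds of a circuit that ends with `last`. -/
noncomputable def circuitRounds
    (last : Amplitudes (Memory n d τ m) ≃ₗᵢ[ℂ] Amplitudes (Memory n d τ m)) :
    List (Stage n d τ m) → List (Query × Matrix.unitaryGroup (Memory n d τ m) ℂ)
  | [] => []
  | σ :: l => (σ.query, isometryMatrix ((σ.toggle.trans σ.post).trans (circuitHead last l))) ::
      circuitRounds last l

theorem length_circuitRounds
    (last : Amplitudes (Memory n d τ m) ≃ₗᵢ[ℂ] Amplitudes (Memory n d τ m))
    (l : List (Stage n d τ m)) : (circuitRounds last l).length = l.length := by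
  induction l with
  | nil => rfl
  | cons σ l ih => simp [circuitRounds, ih]

/-- The algorithm that prepares a state by `prep`, runs a circuit, and tests whether the state is
still the prepared one. -/
noncomputable def returnTest [NeZero n] [NeZero d]
    (prep : Amplitudes (Memory n d τ m) ≃ₗᵢ[ℂ] Amplitudes (Memory n d τ m))
    (l : List (Stage n d τ m)) : QueryAlgorithm n d τ where
  anc := m
  first := isometryMatrix (prep.trans (circuitHead prep.symm l))
  rounds := circuitRounds prep.symm l
  accept := {(false, 0, 0, 0, false, 0)}

variable [NeZero d] {I : VTSInput n d}

/-- The action of a stage. -/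
noncomputable def Stage.run (σ : Stage n d τ m) (O : I.Oracles τ) :
    Amplitudes (Memory n d τ m) →ₗᵢ[ℂ] Amplitudes (Memory n d τ m) :=
  (σ.post.toLinearIsometry.comp σ.toggle.toLinearIsometry).comp
    ((O.isometry m σ.query).comp σ.toggle.toLinearIsometry)

theorem Stage.run_apply (σ : Stage n d τ m) (O : I.Oracles τ)
    (ψ : Amplitudes (Memory n d τ m)) :
    σ.run O ψ = σ.post (σ.toggle (O.isometry m σ.query (σ.toggle ψ))) := rfl

/-- The action of a circuit. -/
noncomputable def runCircuit (O : I.Oracles τ) :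
    List (Stage n d τ m) → Amplitudes (Memory n d τ m) →ₗᵢ[ℂ] Amplitudes (Memory n d τ m)
  | [] => LinearIsometry.id
  | σ :: l => (runCircuit O l).comp (σ.run O)

theorem runCircuit_nil (O : I.Oracles τ) (ψ : Amplitudes (Memory n d τ m)) :
    runCircuit O [] ψ = ψ := rfl

theorem runCircuit_cons (O : I.Oracles τ) (σ : Stage n d τ m) (l : List (Stage n d τ m))
    (ψ : Amplitudes (Memory n d τ m)) :
    runCircuit O (σ :: l) ψ = runCircuit O l (σ.run O ψ) := rfl

theorem runCircuit_append (O : I.Oracles τ) (l l' : List (Stage n d τ m))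
    (ψ : Amplitudes (Memory n d τ m)) :
    runCircuit O (l ++ l') ψ = runCircuit O l' (runCircuit O l ψ) := by
  induction l generalizing ψ with
  | nil => rfl
  | cons σ l ih => simp [runCircuit_cons, ih]

/-- The unitary of a round clears the control bit of its own stage, applies `post`, and already sets
the control bit of the next stage. The fold is thus the same product, bracketed differently. -/
theorem foldl_circuitRounds (O : I.Oracles τ)
    (last : Amplitudes (Memory n d τ m) ≃ₗᵢ[ℂ] Amplitudes (Memory n d τ m))
    (l : List (Stage n d τ m)) (ψ : Amplitudes (Memory n d τ m)) :
    (circuitRounds last l).foldl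
      (fun ψ r => Matrix.mulVec
        (r.2 : Matrix (Memory n d τ m) (Memory n d τ m) ℂ) (O.apply r.1 ψ))
      (circuitHead last l ψ).ofLp = (last (runCircuit O l ψ)).ofLp := by
  induction l generalizing ψ with
  | nil => rfl
  | cons σ l ih =>
    rw [runCircuit_cons, ← ih]
    simp only [circuitRounds, List.foldl_cons, circuitHead]
    congr 1
    have h := VTSInput.Oracles.isometry_apply O σ.query (σ.toggle ψ)
    have h' : O.apply σ.query (σ.toggle ψ).ofLp = (O.isometry m σ.query (σ.toggle ψ)).ofLp := by
      rw [h]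
    rw [h', isometryMatrix_mulVec]
    rfl

/-- The circuit ends by undoing the preparation, so the accepted amplitude is a coefficient at the
all-zero state, which unitarity of `prep` turns into an overlap with `v`. -/
theorem acceptProb_returnTest [NeZero n] (O : I.Oracles τ)
    (prep : Amplitudes (Memory n d τ m) ≃ₗᵢ[ℂ] Amplitudes (Memory n d τ m))
    (l : List (Stage n d τ m)) (v : Amplitudes (Memory n d τ m))
    (hv : prep (EuclideanSpace.single (false, 0, 0, 0, false, 0) 1) = v) :
    (returnTest prep l).acceptProb O = ‖inner ℂ v (runCircuit O l v)‖ ^ 2 := by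
  have hs : (returnTest prep l).finalState O = (prep.symm (runCircuit O l v)).ofLp := by
    have h0 : (Pi.single (false, 0, 0, 0, false, 0) 1 : Memory n d τ m → ℂ) =
        (EuclideanSpace.single (false, 0, 0, 0, false, 0) 1 : Amplitudes (Memory n d τ m)).ofLp := by
      simp
    rw [← foldl_circuitRounds, ← hv]
    simp only [QueryAlgorithm.finalState, returnTest]
    congr 1
    exact (congrArg _ h0).trans (isometryMatrix_mulVec _ _)
  simp only [QueryAlgorithm.acceptProb, hs]
  change ∑ y ∈ ({(false, 0, 0, 0, false, 0)} : Finset (Memory n d τ m)), _ = _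
  rw [Finset.sum_singleton]
  congr 2
  have h1 : v = prep (EuclideanSpace.single (false, 0, 0, 0, false, 0) 1) := hv.symm
  conv_rhs => rw [h1, ← prep.apply_symm_apply (runCircuit O l _), prep.inner_map_map, ← h1]
  simp [EuclideanSpace.inner_single_left]

/-! ### Product states -/

/-- The state `|c⟩ ⊗ χ ⊗ |z⟩` of the memory. -/
noncomputable def regState (χ : StepReg n d τ × Bool → ℂ) (c : Bool) (z : Fin (m + 1)) :
    Amplitudes (Memory n d τ m) :=
  WithLp.toLp 2 fun y => if y.1 = c ∧ y.2.2.2.2.2 = z then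
    χ ((y.2.1, y.2.2.1, y.2.2.2.1), y.2.2.2.2.1) else 0

theorem isometry_regState_false (O : I.Oracles τ) (q : Query) (χ : StepReg n d τ × Bool → ℂ)
    (z : Fin (m + 1)) : O.isometry m q (regState χ false z) = regState χ false z := by
  ext ⟨c, i, w, s, b, z'⟩
  cases q <;> cases c <;>
    simp [VTSInput.Oracles.isometry_apply, VTSInput.Oracles.apply, applyStep, applyDone,
      applyMark, regState]

theorem isometry_done_regState (O : I.Oracles τ) (χ : StepReg n d τ × Bool → ℂ)
    (z : Fin (m + 1)) : O.isometry m .done (regState χ true z) =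
      regState (Matrix.mulVec (O.done : Matrix _ _ ℂ) χ) true z := by
  ext ⟨c, i, w, s, b, z'⟩
  by_cases hz : z' = z <;> cases c <;>
    simp [VTSInput.Oracles.isometry_apply, VTSInput.Oracles.apply, applyDone, regState,
      Matrix.mulVec, dotProduct, hz]

theorem isometry_step_regState (O : I.Oracles τ) (ψ : StepReg n d τ → ℂ) (b : Bool)
    (z : Fin (m + 1)) : O.isometry m .step (regState (withFlag ψ b) true z) =
      regState (withFlag (Matrix.mulVec (O.step : Matrix _ _ ℂ) ψ) b) true z := by
  ext ⟨c, i, w, s, b', z'⟩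
  by_cases hz : z' = z <;> by_cases hb : b' = b <;> cases c <;>
    simp [VTSInput.Oracles.isometry_apply, VTSInput.Oracles.apply, applyStep, regState, withFlag,
      Matrix.mulVec, dotProduct, hz, hb]

theorem isometry_mark_regState (O : I.Oracles τ) {φ φ' : Fin d → ℂ} {b b' : Bool}
    (h : Matrix.mulVec (O.mark : Matrix _ _ ℂ) (withFlag φ b) = withFlag φ' b')
    (i : Fin n) (s : Fin (τ + 1)) (z : Fin (m + 1)) :
    O.isometry m .mark (regState (withFlag (stepState i φ s) b) true z) =
      regState (withFlag (stepState i φ' s) b') true z := by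
  ext ⟨c, i', w, s', b₁, z'⟩
  have h1 := congrFun h (w, b₁)
  simp only [Matrix.mulVec, dotProduct, withFlag, mul_ite, mul_zero] at h1
  by_cases hz : z' = z <;> by_cases hi : i' = i ∧ s' = s <;> cases c <;>
    simp [VTSInput.Oracles.isometry_apply, VTSInput.Oracles.apply, applyMark, regState, withFlag,
      stepState, hz, hi, h1]

theorem toggle_regState (σ : Stage n d τ m) (χ : StepReg n d τ × Bool → ℂ) (c : Bool)
    (z : Fin (m + 1)) : σ.toggle (regState χ c z) = regState χ (xor c (σ.ctrl z)) z := by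
  ext ⟨c', i, w, s, b, z'⟩
  by_cases hz : z' = z
  · subst hz
    cases c <;> cases c' <;> cases h : σ.ctrl z' <;>
      simp [Stage.toggle, involutionIsometry_apply, regState, toggleCtrl, h]
  · simp [Stage.toggle, involutionIsometry_apply, regState, toggleCtrl, hz]

/-- No query touches the further memory, so the same toggle that set the control bit clears it. -/
theorem Stage.run_regState_of_ctrl (σ : Stage n d τ m) (O : I.Oracles τ)
    {χ χ' : StepReg n d τ × Bool → ℂ} {z : Fin (m + 1)} (hc : σ.ctrl z = true)
    (h : O.isometry m σ.query (regState χ true z) = regState χ' true z) :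
    σ.run O (regState χ false z) = σ.post (regState χ' false z) := by
  rw [Stage.run_apply, toggle_regState, hc, Bool.false_xor, h, toggle_regState, hc, Bool.xor_self]

theorem Stage.run_regState_of_not_ctrl (σ : Stage n d τ m) (O : I.Oracles τ)
    {χ : StepReg n d τ × Bool → ℂ} {z : Fin (m + 1)} (hc : σ.ctrl z = false) :
    σ.run O (regState χ false z) = σ.post (regState χ false z) := by
  rw [Stage.run_apply, toggle_regState, hc, Bool.false_xor, isometry_regState_false,
    toggle_regState, hc, Bool.false_xor]

theorem isometry_inv_eq (O : I.Oracles τ) {q : Query} {ψ φ : Amplitudes (Memory n d τ m)}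
    (h : O.isometry m q ψ = φ) : O.isometry m q.inv φ = ψ := by
  rw [← h, VTSInput.Oracles.isometry_inv_apply]

end Circuits

/-! ### The walk on the star graph of paths -/

/-- The content of the further memory: a slot of the clock (`none` is the reference slot) or the
direction of a dart (`true` is away from the root), and a bit recording termination. -/
abbrev Label (K : ℕ) : Type := (Option (Fin K) ⊕ Bool) × Bool

/-- One less than the number of labels. -/
def labelDim (K : ℕ) : ℕ := Fintype.card (Label K) - 1

/-- Numbering of the labels. -/
noncomputable def labelEquiv (K : ℕ) : Fin (labelDim K + 1) ≃ Label K :=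
  Fintype.equivOfCardEq (by
    rw [Fintype.card_fin, labelDim]
    exact Nat.sub_add_cancel Fintype.card_pos)

section Walk

variable {n d τ K : ℕ}

/-- The basis state with control bit `0`. -/
noncomputable def basisState (i : Fin n) (w : Fin d) (s : Fin (τ + 1)) (b : Bool) (z : Label K) :
    Amplitudes (Memory n d τ (labelDim K)) :=
  EuclideanSpace.single (false, i, w, s, b, (labelEquiv K).symm z) 1

/-- Add the flag bit to the termination bit. -/
noncomputable def copyFlag (y : Memory n d τ (labelDim K)) : Memory n d τ (labelDim K) :=
  (y.1, y.2.1, y.2.2.1, y.2.2.2.1, y.2.2.2.2.1, (labelEquiv K).symm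
    ((labelEquiv K y.2.2.2.2.2).1, xor (labelEquiv K y.2.2.2.2.2).2 y.2.2.2.2.1))

theorem copyFlag_involutive : Function.Involutive (copyFlag (n := n) (d := d) (τ := τ) (K := K)) := by
  rintro ⟨c, i, w, s, b, z⟩
  simp [copyFlag]

/-- Reverse the direction of a dart. -/
noncomputable def reverseDart (y : Memory n d τ (labelDim K)) : Memory n d τ (labelDim K) :=
  (y.1, y.2.1, y.2.2.1, y.2.2.2.1, y.2.2.2.2.1, (labelEquiv K).symm
    (Sum.map id not (labelEquiv K y.2.2.2.2.2).1, (labelEquiv K y.2.2.2.2.2).2))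

theorem reverseDart_involutive :
    Function.Involutive (reverseDart (n := n) (d := d) (τ := τ) (K := K)) := by
  rintro ⟨c, i, w, s, b, z⟩
  have h : ∀ l : Option (Fin K) ⊕ Bool, Sum.map id not (Sum.map id not l) = l := by
    rintro (l | l) <;> simp
  simp [reverseDart, h]

/-- The star of the root, with the slot `j` attached with weight `r ^ 2`. -/
noncomputable def rootVector [NeZero n] [NeZero d] (r : ℝ) (j : Fin K) :
    Amplitudes (Memory n d τ (labelDim K)) :=
  (r : ℂ) • basisState 0 0 0 false (Sum.inl (some j), false) +
    ∑ i, basisState i 0 0 false (Sum.inr true, false)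

/-- The star of the vertex after `s + 1` steps of a procedure. -/
noncomputable def pathVector (i : Fin n) (w : Fin d) (s : Fin τ) :
    Amplitudes (Memory n d τ (labelDim K)) :=
  ((Real.sqrt (s + 2) : ℝ) : ℂ) • basisState i w s.succ false (Sum.inr true, false) -
    ((Real.sqrt (s + 1) : ℝ) : ℂ) • basisState i w s.succ false (Sum.inr false, false)

/-- The space spanned by the stars of all vertices except the marked ends. -/
noncomputable def starSpace [NeZero n] [NeZero d] (r : ℝ) (j : Fin K) :
    Submodule ℂ (Amplitudes (Memory n d τ (labelDim K))) :=
  Submodule.span ℂ ({rootVector r j} ∪ {v | ∃ i w s, v = pathVector i w s} ∪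
    {v | ∃ i w s, v = basisState i w s false (Sum.inr false, true)})

/-- The coin: the reflection through the complement of the stars. -/
noncomputable def coin [NeZero n] [NeZero d] (r : ℝ) (j : Fin K) :
    Amplitudes (Memory n d τ (labelDim K)) ≃ₗᵢ[ℂ] Amplitudes (Memory n d τ (labelDim K)) :=
  (starSpace r j)ᗮ.reflection

/-- Whether the label is a dart. -/
noncomputable def isDart (z : Fin (labelDim K + 1)) : Bool := (labelEquiv K z).1.isRight

/-- Whether the termination bit is set. -/
noncomputable def isEnd (z : Fin (labelDim K + 1)) : Bool := (labelEquiv K z).2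

/-- Whether the label is a dart of the given direction. -/
noncomputable def hasDirection (u : Bool) (z : Fin (labelDim K + 1)) : Bool :=
  decide ((labelEquiv K z).1 = Sum.inr u)

/-- Record in the termination bit whether the procedure has ended. -/
noncomputable def doneStages : List (Stage n d τ (labelDim K)) :=
  [⟨isDart, .done, involutionIsometry _ copyFlag_involutive⟩,
   ⟨isDart, .doneInv, LinearIsometryEquiv.refl ℂ _⟩]

/-- Move every dart to the other end of its edge. -/
noncomputable def moveStages : List (Stage n d τ (labelDim K)) :=
  [⟨hasDirection true, .step, LinearIsometryEquiv.refl ℂ _⟩,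
   ⟨hasDirection false, .stepInv, involutionIsometry _ reverseDart_involutive⟩]

/-- One iteration of the walk. -/
noncomputable def walkStages [NeZero n] [NeZero d] (r : ℝ) (j : Fin K) :
    List (Stage n d τ (labelDim K)) :=
  doneStages ++ (⟨isEnd, .mark, coin r j⟩ ::
    (⟨isEnd, .markInv, LinearIsometryEquiv.refl ℂ _⟩ :: (doneStages ++ moveStages)))

theorem length_walkStages [NeZero n] [NeZero d] (r : ℝ) (j : Fin K) :
    (walkStages r j : List (Stage n d τ (labelDim K))).length = 8 := rfl

/-! ### Action of the stages on slots and path states -/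

theorem copyFlag_regState (ψ : StepReg n d τ → ℂ) (b c : Bool) (z : Label K) :
    involutionIsometry _ copyFlag_involutive
      (regState (withFlag ψ b) c ((labelEquiv K).symm z)) =
      regState (withFlag ψ b) c ((labelEquiv K).symm (z.1, xor z.2 b)) := by
  ext ⟨c', i, w, s, b', z'⟩
  obtain ⟨⟨l', q'⟩, rfl⟩ := (labelEquiv K).symm.surjective z'
  obtain ⟨l, q⟩ := z
  by_cases hb : b' = b
  · subst hb
    have : (xor q' b' = q) ↔ (q' = xor q b') := by cases q <;> cases q' <;> cases b' <;> simp
    simp [involutionIsometry_apply, regState, withFlag, copyFlag, this]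
  · simp [involutionIsometry_apply, regState, withFlag, copyFlag, hb]

theorem reverseDart_regState (χ : StepReg n d τ × Bool → ℂ) (c : Bool) (z : Label K) :
    involutionIsometry _ reverseDart_involutive (regState χ c ((labelEquiv K).symm z)) =
      regState χ c ((labelEquiv K).symm (Sum.map id not z.1, z.2)) := by
  ext ⟨c', i, w, s, b', z'⟩
  obtain ⟨⟨l', q'⟩, rfl⟩ := (labelEquiv K).symm.surjective z'
  obtain ⟨l, q⟩ := z
  have : (Sum.map id not l' = l) ↔ (l' = Sum.map id not l) := by
    rcases l with l | l <;> rcases l' with l' | l' <;> cases l <;> cases l' <;> simp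
  simp [involutionIsometry_apply, regState, reverseDart, this]

variable [NeZero d] {I : VTSInput n d}

/-- The state of a procedure after `s` steps, with a flag and a label. -/
noncomputable def pathState (I : VTSInput n d) (τ : ℕ) (i : Fin n) (s : ℕ) (b : Bool)
    (z : Label K) : Amplitudes (Memory n d τ (labelDim K)) :=
  regState (withFlag (stepState i ((I.proc i).state s) (Fin.ofNat (τ + 1) s)) b) false
    ((labelEquiv K).symm z)

theorem pathState_apply (i i' : Fin n) (s : ℕ) (s' : Fin (τ + 1)) (w : Fin d) (b b' : Bool)
    (z z' : Label K) :
    pathState I τ i s b z (false, i', w, s', b', (labelEquiv K).symm z') =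
      if i' = i ∧ s' = Fin.ofNat (τ + 1) s ∧ b' = b ∧ z' = z then (I.proc i).state s w else 0 := by
  by_cases hz : z' = z <;> by_cases hb : b' = b <;>
    simp [pathState, regState, withFlag, stepState, hz, hb]

theorem pathState_eq_sum (i : Fin n) (s : ℕ) (b : Bool) (z : Label K) :
    pathState I τ i s b z =
      ∑ w, (I.proc i).state s w • basisState i w (Fin.ofNat (τ + 1) s) b z := by
  ext ⟨c, i', w, s', b', z'⟩
  obtain ⟨z', rfl⟩ := (labelEquiv K).symm.surjective z'
  cases c
  · rw [pathState_apply]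
    by_cases h : i' = i ∧ s' = Fin.ofNat (τ + 1) s ∧ b' = b ∧ z' = z
    · obtain ⟨rfl, rfl, rfl, rfl⟩ := h
      simp [basisState, Pi.single_apply]
    · rw [if_neg h]
      simp only [WithLp.ofLp_sum, Finset.sum_apply]
      symm
      apply Finset.sum_eq_zero
      intro w' _
      simp only [basisState, PiLp.smul_apply, PiLp.single_apply]
      rw [if_neg, smul_zero]
      intro h'
      simp only [Prod.mk.injEq, EmbeddingLike.apply_eq_iff_eq] at h'
      tauto
  · simp [pathState, regState, basisState]

theorem pathState_zero (i : Fin n) (b : Bool) (z : Label K) :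
    pathState I τ i 0 b z = basisState i 0 0 b z := by
  rw [pathState_eq_sum]
  simp [Procedure.state, Pi.single_apply]

theorem doneStages_slot (O : I.Oracles τ) (χ : StepReg n d τ → ℂ) (k : Option (Fin K)) :
    runCircuit O doneStages (regState (withFlag χ false) false
      ((labelEquiv K).symm (Sum.inl k, false))) =
      regState (withFlag χ false) false ((labelEquiv K).symm (Sum.inl k, false)) := by
  simp only [doneStages, runCircuit_cons, runCircuit_nil]
  rw [Stage.run_regState_of_not_ctrl _ _ (by simp [isDart])]
  rw [copyFlag_regState, Bool.xor_false,
    Stage.run_regState_of_not_ctrl _ _ (by simp [isDart])]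
  rfl

theorem moveStages_slot (O : I.Oracles τ) (χ : StepReg n d τ × Bool → ℂ) (k : Option (Fin K))
    (q : Bool) :
    runCircuit O moveStages (regState χ false ((labelEquiv K).symm (Sum.inl k, q))) =
      regState χ false ((labelEquiv K).symm (Sum.inl k, q)) := by
  simp only [moveStages, runCircuit_cons, runCircuit_nil]
  rw [Stage.run_regState_of_not_ctrl _ _ (by simp [hasDirection])]
  rw [LinearIsometryEquiv.coe_refl, id_eq,
    Stage.run_regState_of_not_ctrl _ _ (by simp [hasDirection]), reverseDart_regState]
  rfl

/-- Compute, copy, uncompute: the answer is added to the termination bit and the inverse oracle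
clears the flag. As the copy is an XOR, a second run erases the record. -/
theorem doneStages_path (O : I.Oracles τ) {i : Fin n} {s : ℕ} (hs : s ≤ I.time i) (hτ : s ≤ τ)
    (u q : Bool) :
    runCircuit O doneStages (pathState I τ i s false (Sum.inr u, q) : Amplitudes (Memory n d τ (labelDim K))) =
      pathState I τ i s false (Sum.inr u, xor q (decide (I.time i ≤ s))) := by
  have hv : ((Fin.ofNat (τ + 1) s : Fin (τ + 1)) : ℕ) = s := by
    simp [Fin.ofNat, Nat.mod_eq_of_lt (Nat.lt_succ_of_le hτ)]
  have hd := O.done_spec i (Fin.ofNat (τ + 1) s) (by rw [hv]; exact hs)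
  rw [hv] at hd
  have hq : ∀ z : Label K, O.isometry (labelDim K) .done (regState (withFlag (stepState i ((I.proc i).state s)
      (Fin.ofNat (τ + 1) s)) false) true ((labelEquiv K).symm z)) =
      regState (withFlag (stepState i ((I.proc i).state s)
      (Fin.ofNat (τ + 1) s)) (decide (I.time i ≤ s))) true ((labelEquiv K).symm z) := by
    intro z
    rw [isometry_done_regState, hd]
  simp only [doneStages, runCircuit_cons, runCircuit_nil, pathState]
  rw [Stage.run_regState_of_ctrl _ _ (by simp [isDart]) (hq _), copyFlag_regState,
    Stage.run_regState_of_ctrl _ _ (by simp [isDart]) (isometry_inv_eq O (hq _))]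
  rfl

theorem mark_path (O : I.Oracles τ) (i : Fin n) (z : Fin (labelDim K + 1)) :
    O.isometry (labelDim K) .mark (regState (withFlag (stepState i ((I.proc i).state (I.time i))
      (Fin.ofNat (τ + 1) (I.time i))) false) true z) =
      regState (withFlag (stepState i ((I.proc i).state (I.time i))
      (Fin.ofNat (τ + 1) (I.time i))) (I.x i)) true z :=
  isometry_mark_regState O (O.mark_spec i) _ _ _

theorem isometry_step_path (O : I.Oracles τ) {i : Fin n} {s : ℕ} (hs : s < I.time i)
    (hτ : I.time i ≤ τ) (z : Fin (labelDim K + 1)) :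
    O.isometry (labelDim K) .step (regState (withFlag (stepState i ((I.proc i).state s)
      (Fin.ofNat (τ + 1) s)) false) true z) =
      regState (withFlag (stepState i ((I.proc i).state (s + 1))
      (Fin.ofNat (τ + 1) (s + 1))) false) true z := by
  have h := O.step_spec i ⟨s, hs.trans_le hτ⟩ hs
  have h1 : (⟨s, hs.trans_le hτ⟩ : Fin τ).castSucc = Fin.ofNat (τ + 1) s := by
    ext
    simp only [Fin.val_castSucc, Fin.ofNat]
    exact (Nat.mod_eq_of_lt (by omega)).symm
  have h2 : (⟨s, hs.trans_le hτ⟩ : Fin τ).succ = Fin.ofNat (τ + 1) (s + 1) := by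
    ext
    simp only [Fin.val_succ, Fin.ofNat]
    exact (Nat.mod_eq_of_lt (by omega)).symm
  rw [h1, h2] at h
  rw [isometry_step_regState, h]

/-- The direction is reversed only after both queries, so a dart moved by `step` is not moved back
by `stepInv`. -/
theorem moveStages_up (O : I.Oracles τ) {i : Fin n} {s : ℕ} (hs : s < I.time i)
    (hτ : I.time i ≤ τ) :
    runCircuit O moveStages (pathState (K := K) I τ i s false (Sum.inr true, false)) =
      pathState I τ i (s + 1) false (Sum.inr false, false) := by
  simp only [moveStages, runCircuit_cons, runCircuit_nil, pathState]
  rw [Stage.run_regState_of_ctrl _ _ (by simp [hasDirection]) (isometry_step_path O hs hτ _)]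
  rw [LinearIsometryEquiv.coe_refl, id_eq,
    Stage.run_regState_of_not_ctrl _ _ (by simp [hasDirection]), reverseDart_regState]
  rfl

theorem moveStages_down (O : I.Oracles τ) {i : Fin n} {s : ℕ} (hs : s < I.time i)
    (hτ : I.time i ≤ τ) :
    runCircuit O moveStages (pathState (K := K) I τ i (s + 1) false (Sum.inr false, false)) =
      pathState I τ i s false (Sum.inr true, false) := by
  simp only [moveStages, runCircuit_cons, runCircuit_nil, pathState]
  rw [Stage.run_regState_of_not_ctrl _ _ (by simp [hasDirection]), LinearIsometryEquiv.coe_refl,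
    id_eq, Stage.run_regState_of_ctrl _ _ (by simp [hasDirection])
      (isometry_inv_eq O (isometry_step_path O hs hτ _)), reverseDart_regState]
  rfl

/-- The state of a procedure after `s` steps, tagged with what the oracles tell about it. -/
noncomputable def taggedState (I : VTSInput n d) (τ : ℕ) (i : Fin n) (s : ℕ) (u : Bool) :
    Amplitudes (Memory n d τ (labelDim K)) :=
  pathState I τ i s (decide (I.time i ≤ s) && I.x i) (Sum.inr u, decide (I.time i ≤ s))

/-- The stages of an iteration before the coin. -/
noncomputable def tagStages : List (Stage n d τ (labelDim K)) :=
  doneStages ++ [⟨isEnd, .mark, LinearIsometryEquiv.refl ℂ _⟩]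

/-- The stages of an iteration after the coin. -/
noncomputable def untagStages : List (Stage n d τ (labelDim K)) :=
  ⟨isEnd, .markInv, LinearIsometryEquiv.refl ℂ _⟩ :: (doneStages ++ moveStages)

theorem runCircuit_walkStages [NeZero n] (O : I.Oracles τ) (r : ℝ) (j : Fin K)
    (ψ : Amplitudes (Memory n d τ (labelDim K))) :
    runCircuit O (walkStages r j) ψ =
      runCircuit O untagStages (coin r j (runCircuit O tagStages ψ)) := by
  simp only [walkStages, tagStages, untagStages, runCircuit_append, runCircuit_cons,
    runCircuit_nil]
  rfl

/-- Before the end the termination bit is clear, so the output oracle, which is unspecified there,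
is not triggered. At the end its answer stays in the flag while the coin acts. -/
theorem tagStages_path (O : I.Oracles τ) {i : Fin n} {s : ℕ} (hs : s ≤ I.time i)
    (hτ : I.time i ≤ τ) (u : Bool) :
    runCircuit O tagStages (pathState (K := K) I τ i s false (Sum.inr u, false)) =
      taggedState I τ i s u := by
  rw [tagStages, runCircuit_append, doneStages_path O hs (hs.trans hτ), Bool.false_xor,
    runCircuit_cons, runCircuit_nil, taggedState]
  rcases hs.lt_or_eq with h | rfl
  · have h' : decide (I.time i ≤ s) = false := by simpa using h
    rw [h', Bool.false_and, pathState,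
      Stage.run_regState_of_not_ctrl _ _ (by simp [isEnd])]
    rfl
  · have h' : decide (I.time i ≤ I.time i) = true := by simp
    rw [h', Bool.true_and, pathState,
      Stage.run_regState_of_ctrl _ _ (by simp [isEnd]) (mark_path O i _)]
    rfl

theorem untagStages_tagged (O : I.Oracles τ) {i : Fin n} {s : ℕ} (hs : s ≤ I.time i)
    (hτ : I.time i ≤ τ) (u : Bool) :
    runCircuit O untagStages (taggedState (K := K) I τ i s u) =
      runCircuit O moveStages (pathState I τ i s false (Sum.inr u, false)) := by
  have key : Stage.run ⟨isEnd, .markInv, LinearIsometryEquiv.refl ℂ _⟩ O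
      (taggedState (K := K) I τ i s u) =
      pathState I τ i s false (Sum.inr u, decide (I.time i ≤ s)) := by
    rw [taggedState]
    rcases hs.lt_or_eq with h | rfl
    · have h' : decide (I.time i ≤ s) = false := by simpa using h
      rw [h', Bool.false_and, pathState,
        Stage.run_regState_of_not_ctrl _ _ (by simp [isEnd])]
      rfl
    · have h' : decide (I.time i ≤ I.time i) = true := by simp
      rw [h', Bool.true_and, pathState,
        Stage.run_regState_of_ctrl _ _ (by simp [isEnd]) (isometry_inv_eq O (mark_path O i _))]
      rfl
  rw [untagStages, runCircuit_cons, key, runCircuit_append, doneStages_path O hs (hs.trans hτ),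
    Bool.xor_self]

theorem untagStages_up (O : I.Oracles τ) {i : Fin n} {s : ℕ} (hs : s < I.time i)
    (hτ : I.time i ≤ τ) :
    runCircuit O untagStages (taggedState (K := K) I τ i s true) =
      pathState I τ i (s + 1) false (Sum.inr false, false) := by
  rw [untagStages_tagged O hs.le hτ, moveStages_up O hs hτ]

theorem untagStages_down (O : I.Oracles τ) {i : Fin n} {s : ℕ} (hs : s < I.time i)
    (hτ : I.time i ≤ τ) :
    runCircuit O untagStages (taggedState (K := K) I τ i (s + 1) false) =
      pathState I τ i s false (Sum.inr true, false) := by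
  rw [untagStages_tagged O hs hτ, moveStages_down O hs hτ]

/-- The basis state of a slot of the clock. -/
noncomputable def slotState (n d τ : ℕ) [NeZero n] [NeZero d] (k : Option (Fin K)) :
    Amplitudes (Memory n d τ (labelDim K)) :=
  basisState 0 0 0 false (Sum.inl k, false)

theorem slotState_eq (I : VTSInput n d) [NeZero n] (k : Option (Fin K)) :
    slotState n d τ k = regState (withFlag (stepState 0 ((I.proc 0).state 0)
      (Fin.ofNat (τ + 1) 0)) false) false ((labelEquiv K).symm (Sum.inl k, false)) :=
  (pathState_zero (I := I) (τ := τ) 0 false (Sum.inl k, false)).symm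

theorem tagStages_slot [NeZero n] (O : I.Oracles τ) (k : Option (Fin K)) :
    runCircuit O tagStages (slotState n d τ k) = slotState n d τ k := by
  rw [slotState_eq I, tagStages, runCircuit_append, doneStages_slot, runCircuit_cons,
    runCircuit_nil, Stage.run_regState_of_not_ctrl _ _ (by simp [isEnd])]
  rfl

theorem untagStages_slot [NeZero n] (O : I.Oracles τ) (k : Option (Fin K)) :
    runCircuit O untagStages (slotState n d τ k) = slotState n d τ k := by
  rw [slotState_eq I, untagStages, runCircuit_cons,
    Stage.run_regState_of_not_ctrl _ _ (by simp [isEnd])]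
  rw [LinearIsometryEquiv.coe_refl, id_eq, runCircuit_append, doneStages_slot, moveStages_slot]

end Walk

/-! ### Stars, the coin, potential and flow -/

section Walk

variable {n d τ K : ℕ} [NeZero n] [NeZero d] {I : VTSInput n d}

theorem coin_of_mem {r : ℝ} {j : Fin K} {ψ : Amplitudes (Memory n d τ (labelDim K))}
    (h : ψ ∈ starSpace r j) : coin r j ψ = -ψ :=
  Submodule.reflection_mem_subspace_orthogonal_precomplement_eq_neg h

theorem coin_of_orthogonal {r : ℝ} {j : Fin K} {ψ : Amplitudes (Memory n d τ (labelDim K))}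
    (h : ψ ∈ (starSpace r j)ᗮ) : coin r j ψ = ψ :=
  Submodule.reflection_mem_subspace_eq_self h

/-- The hypotheses express orthogonality to the three kinds of generators. These range over all
workspace contents and counter values, so the coin does not depend on the input. All have flag `0`,
so a marked end, whose flag is set, is under no constraint. -/
theorem mem_orthogonal_starSpace {r : ℝ} {j : Fin K}
    {ψ : Amplitudes (Memory n d τ (labelDim K))}
    (hroot : (r : ℂ) * ψ (false, 0, 0, 0, false, (labelEquiv K).symm (Sum.inl (some j), false)) +
      ∑ i, ψ (false, i, 0, 0, false, (labelEquiv K).symm (Sum.inr true, false)) = 0)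
    (hpath : ∀ (i : Fin n) (w : Fin d) (s : Fin τ),
      ((Real.sqrt (s + 2) : ℝ) : ℂ) *
        ψ (false, i, w, s.succ, false, (labelEquiv K).symm (Sum.inr true, false)) =
      ((Real.sqrt (s + 1) : ℝ) : ℂ) *
        ψ (false, i, w, s.succ, false, (labelEquiv K).symm (Sum.inr false, false)))
    (hend : ∀ (i : Fin n) (w : Fin d) (s : Fin (τ + 1)),
      ψ (false, i, w, s, false, (labelEquiv K).symm (Sum.inr false, true)) = 0) :
    ψ ∈ (starSpace r j)ᗮ := by
  rw [starSpace, Submodule.mem_orthogonal]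
  intro u hu
  induction hu using Submodule.span_induction with
  | mem u hu =>
    rcases hu with (rfl | ⟨i, w, s, rfl⟩) | ⟨i, w, s, rfl⟩
    · simpa [rootVector, basisState, inner_add_left, inner_smul_left, sum_inner,
        EuclideanSpace.inner_single_left, -Complex.coe_smul] using hroot
    · simp [pathVector, basisState, inner_sub_left, inner_smul_left,
        EuclideanSpace.inner_single_left, hpath i w s, -Complex.coe_smul]
    · simp [basisState, EuclideanSpace.inner_single_left, hend]
  | zero => simp
  | add u v _ _ hu hv => rw [inner_add_left, hu, hv, add_zero]
  | smul a u _ hu => rw [inner_smul_left, hu, mul_zero]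

theorem rootVector_mem (r : ℝ) (j : Fin K) :
    (rootVector r j : Amplitudes (Memory n d τ (labelDim K))) ∈ starSpace r j :=
  Submodule.subset_span (Or.inl (Or.inl rfl))

theorem ofNat_eq_succ {s : ℕ} (hs : s < τ) : Fin.ofNat (τ + 1) (s + 1) = (⟨s, hs⟩ : Fin τ).succ := by
  ext
  simp only [Fin.val_succ, Fin.ofNat]
  exact Nat.mod_eq_of_lt (by omega)

/-- The weights do not depend on the workspace, so the star at the actual content is a combination
of basis stars, with the amplitudes of that content. -/
theorem star_path_mem (r : ℝ) (j : Fin K) (i : Fin n) {s : ℕ} (hs : s < τ) :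
    ((Real.sqrt (s + 2) : ℝ) : ℂ) • pathState I τ i (s + 1) false (Sum.inr true, false) -
      ((Real.sqrt (s + 1) : ℝ) : ℂ) • pathState I τ i (s + 1) false (Sum.inr false, false) ∈
        starSpace (τ := τ) r j := by
  have h : ((Real.sqrt (s + 2) : ℝ) : ℂ) • pathState I τ i (s + 1) false (Sum.inr true, false) -
      ((Real.sqrt (s + 1) : ℝ) : ℂ) • pathState I τ i (s + 1) false (Sum.inr false, false) =
      ∑ w, (I.proc i).state (s + 1) w • (pathVector i w ⟨s, hs⟩ :
        Amplitudes (Memory n d τ (labelDim K))) := by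
    simp only [pathState_eq_sum, pathVector, ofNat_eq_succ hs, smul_sub, Finset.sum_sub_distrib,
      Finset.smul_sum, smul_comm ((I.proc i).state (s + 1) _)]
  rw [h]
  exact Submodule.sum_mem _ fun w _ => Submodule.smul_mem _ _
    (Submodule.subset_span (Or.inl (Or.inr ⟨_, _, _, rfl⟩)))

theorem star_end_mem (r : ℝ) (j : Fin K) (i : Fin n) (s : ℕ) :
    pathState I τ i s false (Sum.inr false, true) ∈ starSpace (τ := τ) r j := by
  rw [pathState_eq_sum]
  exact Submodule.sum_mem _ fun w _ => Submodule.smul_mem _ _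
    (Submodule.subset_span (Or.inr ⟨_, _, _, rfl⟩))

theorem taggedState_of_lt (i : Fin n) {s : ℕ} (hs : s < I.time i) (u : Bool) :
    taggedState (K := K) I τ i s u = pathState I τ i s false (Sum.inr u, false) := by
  have h' : decide (I.time i ≤ s) = false := by simpa using hs
  rw [taggedState, h', Bool.false_and]

theorem taggedState_end (i : Fin n) (u : Bool) :
    taggedState (K := K) I τ i (I.time i) u =
      pathState I τ i (I.time i) (I.x i) (Sum.inr u, true) := by
  have h' : decide (I.time i ≤ I.time i) = true := by simp
  rw [taggedState, h', Bool.true_and]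

/-- Summation by vertices instead of edges along a path. -/
theorem sum_edges_eq_sum_vertices {M : Type*} [AddCommGroup M] (f g : ℕ → M) (t : ℕ) :
    ∑ s ∈ Finset.range (t + 1), (f s + g s) =
      f 0 + ∑ s ∈ Finset.range t, (f (s + 1) + g s) + g t := by
  rw [Finset.sum_add_distrib, Finset.sum_add_distrib, Finset.sum_range_succ' f,
    Finset.sum_range_succ g]
  abel

/-- The vector with coefficient `a i s` on both darts of the edge `(i, s)`, with relative sign
`ε`. -/
noncomputable def edgeVector (I : VTSInput n d) (τ K : ℕ) (ε : ℂ) (a : Fin n → ℕ → ℂ) :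
    Amplitudes (Memory n d τ (labelDim K)) :=
  ∑ i, ∑ s ∈ Finset.range (I.time i), a i s •
    (pathState I τ i s false (Sum.inr true, false) +
      ε • pathState I τ i (s + 1) false (Sum.inr false, false))

/-- The tagged version of `edgeVector`. -/
noncomputable def taggedEdgeVector (I : VTSInput n d) (τ K : ℕ) (ε : ℂ) (a : Fin n → ℕ → ℂ) :
    Amplitudes (Memory n d τ (labelDim K)) :=
  ∑ i, ∑ s ∈ Finset.range (I.time i), a i s •
    (taggedState I τ i s true + ε • taggedState I τ i (s + 1) false)

theorem time_le_maxTime (I : VTSInput n d) (i : Fin n) : I.time i ≤ I.maxTime :=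
  Finset.le_sup (f := I.time) (Finset.mem_univ i)

theorem tagStages_edgeVector (O : I.Oracles τ) (hτ : I.maxTime ≤ τ) (ε : ℂ)
    (a : Fin n → ℕ → ℂ) :
    runCircuit O tagStages (edgeVector I τ K ε a) = taggedEdgeVector I τ K ε a := by
  simp only [edgeVector, taggedEdgeVector, map_sum, map_smul, map_add]
  refine Finset.sum_congr rfl fun i _ => Finset.sum_congr rfl fun s hs => ?_
  have hs := Finset.mem_range.1 hs
  have ht := (time_le_maxTime I i).trans hτ
  rw [tagStages_path O hs.le ht, tagStages_path O hs ht]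

/-- Moving exchanges the two darts of every edge; on darts of relative sign `ε` with `ε² = 1` this
is multiplication by `ε`. -/
theorem untagStages_edgeVector (O : I.Oracles τ) (hτ : I.maxTime ≤ τ) {ε : ℂ} (hε : ε * ε = 1)
    (a : Fin n → ℕ → ℂ) :
    runCircuit O untagStages (taggedEdgeVector I τ K ε a) = ε • edgeVector I τ K ε a := by
  simp only [edgeVector, taggedEdgeVector, map_sum, map_smul, map_add, Finset.smul_sum]
  refine Finset.sum_congr rfl fun i _ => Finset.sum_congr rfl fun s hs => ?_
  have hs := Finset.mem_range.1 hs
  have ht := (time_le_maxTime I i).trans hτ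
  rw [untagStages_up O hs ht, untagStages_down O hs ht, smul_comm ε (a i s), smul_add ε, smul_smul ε ε,
    hε, one_smul, add_comm]

/-- The coefficients of the potential. -/
noncomputable def potentialCoeff (_ : Fin n) (s : ℕ) : ℂ := ((Real.sqrt (s + 1) : ℝ) : ℂ)

/-- The coefficients of the flow to the end of procedure `i₀`. -/
noncomputable def flowCoeff (r : ℝ) (i₀ : Fin n) (i : Fin n) (s : ℕ) : ℂ :=
  if i = i₀ then ((-r / Real.sqrt (s + 1) : ℝ) : ℂ) else 0

theorem time_pos (I : VTSInput n d) (i : Fin n) : 0 < I.time i := (I.proc i).time_pos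

/-- The amplitudes are the roots of the edge weights, with opposite signs on the two darts of an
edge. Collected by vertices they form the stars of all vertices, including every end because none is
marked. -/
theorem potential_mem (hτ : I.maxTime ≤ τ) (hx : ∀ i, I.x i = false) (r : ℝ) (j : Fin K) :
    (r : ℂ) • slotState n d τ (some j) + taggedEdgeVector I τ K (-1) potentialCoeff ∈
      starSpace r j := by
  have key : ∀ i, ∑ s ∈ Finset.range (I.time i), potentialCoeff i s •
      (taggedState I τ i s true + (-1 : ℂ) • taggedState I τ i (s + 1) false) -
      basisState i 0 0 false (Sum.inr true, false) ∈ starSpace (τ := τ) r j := by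
    intro i
    have ht := (time_le_maxTime I i).trans hτ
    obtain ⟨t, ht'⟩ := Nat.exists_eq_succ_of_ne_zero (time_pos I i).ne'
    have hte := taggedState_end (K := K) (τ := τ) (I := I) i false
    rw [ht', Nat.succ_eq_add_one] at hte
    simp only [smul_add]
    -- The three groups are the dart at the root, which belongs to the root's star, the interior
    -- stars, and a multiple of the star of the end.
    rw [ht', Nat.succ_eq_add_one, sum_edges_eq_sum_vertices, hte,
      taggedState_of_lt i (time_pos I i), pathState_zero, hx]
    have h0 : potentialCoeff i 0 = 1 := by simp [potentialCoeff]
    rw [h0, one_smul, add_assoc, add_sub_cancel_left]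
    refine Submodule.add_mem _ (Submodule.sum_mem _ fun s hs => ?_)
      (Submodule.smul_mem _ _ (Submodule.smul_mem _ _ (star_end_mem r j i _)))
    have hs := Finset.mem_range.1 hs
    have hs' : s + 1 < I.time i := by omega
    rw [taggedState_of_lt i hs', taggedState_of_lt i hs']
    convert star_path_mem (K := K) (τ := τ) (I := I) r j i (s := s) (by omega) using 1
    rw [sub_eq_add_neg, ← smul_neg, neg_one_smul]
    simp only [potentialCoeff]
    push_cast
    ring_nf
  have hsum := Submodule.sum_mem (starSpace (n := n) (d := d) (τ := τ) r j)
    (t := Finset.univ) fun i _ => key i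
  have := Submodule.add_mem _ (rootVector_mem (n := n) (d := d) (τ := τ) r j) hsum
  convert this using 1
  rw [rootVector, Finset.sum_sub_distrib, taggedEdgeVector, slotState]
  abel

/-- The coin negates the whole vector and the exchange of darts negates the edge part again, so only
the slot changes sign. -/
theorem walk_potential (O : I.Oracles τ) (hτ : I.maxTime ≤ τ) (hx : ∀ i, I.x i = false) (r : ℝ)
    (j : Fin K) :
    runCircuit O (walkStages r j)
        ((r : ℂ) • slotState n d τ (some j) + edgeVector I τ K (-1) potentialCoeff) =
      (-1 : ℂ) • (r : ℂ) • slotState n d τ (some j) + edgeVector I τ K (-1) potentialCoeff := by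
  rw [runCircuit_walkStages, map_add, map_smul, tagStages_slot, tagStages_edgeVector O hτ,
    coin_of_mem (potential_mem hτ hx r j), map_neg, map_add, map_smul, untagStages_slot,
    untagStages_edgeVector O hτ (by norm_num)]
  module

/-- Kirchhoff's law: times the root of the edge weight, each amplitude is the current `-r`, so the
two edges at an interior vertex cancel. -/
theorem flow_mem (hτ : I.maxTime ≤ τ) {i₀ : Fin n} (hx : I.x i₀ = true) (r : ℝ) (j : Fin K) :
    slotState n d τ (some j) + taggedEdgeVector I τ K 1 (flowCoeff r i₀) ∈ (starSpace r j)ᗮ := by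
  have hsum : taggedEdgeVector I τ K 1 (flowCoeff r i₀) = ∑ s ∈ Finset.range (I.time i₀),
      (((-r / Real.sqrt (s + 1) : ℝ) : ℂ) • taggedState I τ i₀ s true +
        ((-r / Real.sqrt (s + 1) : ℝ) : ℂ) • taggedState I τ i₀ (s + 1) false) := by
    rw [taggedEdgeVector, Finset.sum_eq_single i₀]
    · simp [flowCoeff]
    · intro i _ hi
      simp [flowCoeff, hi]
    · simp
  have ht := (time_le_maxTime I i₀).trans hτ
  obtain ⟨t, ht'⟩ := Nat.exists_eq_succ_of_ne_zero (time_pos I i₀).ne'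
  have hte := taggedState_end (K := K) (τ := τ) (I := I) i₀ false
  rw [ht', Nat.succ_eq_add_one] at hte
  rw [hsum, ht', Nat.succ_eq_add_one, sum_edges_eq_sum_vertices, hte,
    taggedState_of_lt i₀ (time_pos I i₀), pathState_zero, hx, ← add_assoc, ← add_assoc]
  refine Submodule.add_mem _ (Submodule.add_mem _ ?_ (Submodule.sum_mem _ fun s hs => ?_))
    (Submodule.smul_mem _ _ ?_)
  -- At the root the slot contributes `r` and the first dart `-r / √1`.
  · apply mem_orthogonal_starSpace
    · simp [slotState, basisState, PiLp.single_apply]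
    · intro i w s
      simp [slotState, basisState, Fin.succ_ne_zero]
    · intro i w s
      simp [slotState, basisState]
  · have hs := Finset.mem_range.1 hs
    have hs' : s + 1 < I.time i₀ := by omega
    rw [taggedState_of_lt i₀ hs', taggedState_of_lt i₀ hs']
    apply mem_orthogonal_starSpace
    · have : (0 : Fin (τ + 1)) ≠ Fin.ofNat (τ + 1) (s + 1) := by
        rw [ofNat_eq_succ (by omega : s < τ)]
        exact (Fin.succ_ne_zero _).symm
      simp [pathState_apply, this, -Fin.ofNat_eq_cast]
    · intro i w s'
      simp only [PiLp.add_apply, PiLp.smul_apply, pathState_apply,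
        ofNat_eq_succ (by omega : s < τ)]
      by_cases h : i = i₀ ∧ s' = ⟨s, by omega⟩
      · obtain ⟨rfl, rfl⟩ := h
        have h1 : ((Real.sqrt (s + 1) : ℝ) : ℂ) ≠ 0 := by
          exact_mod_cast (Real.sqrt_pos.2 (by positivity)).ne'
        have h2 : ((Real.sqrt (s + 2) : ℝ) : ℂ) ≠ 0 := by
          exact_mod_cast (Real.sqrt_pos.2 (by positivity)).ne'
        have h3 : (s : ℝ) + 1 + 1 = s + 2 := by ring
        simp [h3]
        field_simp
      · simp only [Fin.succ_inj, ← and_assoc, h, false_and, if_false, smul_zero, add_zero,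
          mul_zero]
    · intro i w s'
      simp [pathState_apply]
  -- The current may leave at the marked end: its flag is set, and no star has the flag set.
  · apply mem_orthogonal_starSpace <;> simp [pathState_apply]

theorem walk_flow (O : I.Oracles τ) (hτ : I.maxTime ≤ τ) {i₀ : Fin n} (hx : I.x i₀ = true)
    (r : ℝ) (j : Fin K) :
    runCircuit O (walkStages r j)
        (slotState n d τ (some j) + edgeVector I τ K 1 (flowCoeff r i₀)) =
      slotState n d τ (some j) + edgeVector I τ K 1 (flowCoeff r i₀) := by
  rw [runCircuit_walkStages, map_add, tagStages_slot, tagStages_edgeVector O hτ,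
    coin_of_orthogonal (flow_mem hτ hx r j), map_add, untagStages_slot,
    untagStages_edgeVector O hτ (by norm_num), one_smul]

/-- A slot label triggers no query, and a slot other than `j`, the reference included, is orthogonal
to every star. -/
theorem walk_slot (O : I.Oracles τ) (r : ℝ) {j : Fin K} {k : Option (Fin K)} (hk : k ≠ some j) :
    runCircuit O (walkStages r j) (slotState n d τ k) = slotState n d τ k := by
  rw [runCircuit_walkStages, tagStages_slot, coin_of_orthogonal, untagStages_slot]
  apply mem_orthogonal_starSpace <;>
    simp [slotState, basisState, hk.symm]

end Walk

/-! ### Norms -/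

theorem norm_sq_sum_smul_of_orthonormal {ι E : Type*} [DecidableEq ι] [NormedAddCommGroup E]
    [InnerProductSpace ℂ E] (S : Finset ι) (v : ι → E) (a : ι → ℂ)
    (h : ∀ x ∈ S, ∀ y ∈ S, inner ℂ (v x) (v y) = if x = y then (1 : ℂ) else 0) :
    ‖∑ x ∈ S, a x • v x‖ ^ 2 = ∑ x ∈ S, ‖a x‖ ^ 2 := by
  have h1 : inner ℂ (∑ x ∈ S, a x • v x) (∑ x ∈ S, a x • v x) =
      ((∑ x ∈ S, ‖a x‖ ^ 2 : ℝ) : ℂ) := by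
    rw [sum_inner, Complex.ofReal_sum]
    refine Finset.sum_congr rfl fun x hx => ?_
    rw [inner_sum, Finset.sum_eq_single x]
    · rw [inner_smul_left, inner_smul_right, h x hx x hx, if_pos rfl, mul_one, Complex.conj_mul']
      push_cast
      rfl
    · intro y hy hyx
      rw [inner_smul_left, inner_smul_right, h x hx y hy, if_neg hyx.symm, mul_zero, mul_zero]
    · exact fun hx' => absurd hx hx'
  rw [inner_self_eq_norm_sq_to_K] at h1
  have h2 : ((‖∑ x ∈ S, a x • v x‖ : ℝ) : ℂ) ^ 2 = ((∑ x ∈ S, ‖a x‖ ^ 2 : ℝ) : ℂ) := h1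
  exact_mod_cast h2

theorem Procedure.sum_norm_sq_state {d : ℕ} [NeZero d] (P : Procedure d) (s : ℕ) :
    ∑ w, ‖P.state s w‖ ^ 2 = 1 := by
  induction s with
  | zero => simp [Procedure.state, Pi.single_apply, apply_ite]
  | succ s ih => rw [Procedure.state, sum_norm_sq_unitary_mulVec, ih]

section Walk

variable {n d τ K : ℕ} [NeZero n] [NeZero d] {I : VTSInput n d}

/-- Workspace contents of different steps need not be orthogonal; the index and counter registers
separate the vertices. The bounds by `τ` prevent the counter from wrapping around. -/
theorem inner_pathState {s s' : ℕ} (hs : s ≤ τ) (hs' : s' ≤ τ) (i i' : Fin n) (b : Bool)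
    (z : Label K) : inner ℂ (pathState I τ i s b z) (pathState I τ i' s' b z) =
      if i = i' ∧ s = s' then (1 : ℂ) else 0 := by
  have hv : Fin.ofNat (τ + 1) s = Fin.ofNat (τ + 1) s' ↔ s = s' := by
    rw [Fin.ext_iff]
    simp only [Fin.ofNat]
    rw [Nat.mod_eq_of_lt (Nat.lt_succ_of_le hs), Nat.mod_eq_of_lt (Nat.lt_succ_of_le hs')]
  rw [pathState_eq_sum, sum_inner]
  simp only [inner_smul_left, basisState, EuclideanSpace.inner_single_left, pathState_apply, hv,
    map_one, one_mul, and_true]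
  split_ifs with h
  · obtain ⟨rfl, rfl⟩ := h
    simp only [Complex.conj_mul']
    exact_mod_cast (I.proc i).sum_norm_sq_state s
  · simp

theorem norm_sq_sum_pathState (hτ : I.maxTime ≤ τ) (a : Fin n → ℕ → ℂ) {c : ℕ} (hc : c ≤ 1)
    (z : Label K) :
    ‖∑ i, ∑ s ∈ Finset.range (I.time i), a i s • pathState I τ i (s + c) false z‖ ^ 2 =
      ∑ i, ∑ s ∈ Finset.range (I.time i), ‖a i s‖ ^ 2 := by
  rw [Finset.sum_sigma', Finset.sum_sigma']
  refine norm_sq_sum_smul_of_orthonormal _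
    (fun x : (_ : Fin n) × ℕ => pathState I τ x.1 (x.2 + c) false z) (fun x => a x.1 x.2) ?_
  have hle : ∀ x ∈ Finset.univ.sigma fun i => Finset.range (I.time i), x.2 + c ≤ τ := by
    intro x hx
    have h1 := Finset.mem_range.1 (Finset.mem_sigma.1 hx).2
    have h2 := (time_le_maxTime I x.1).trans hτ
    omega
  rintro ⟨i, s⟩ hx ⟨i', s'⟩ hy
  rw [inner_pathState (hle _ hx) (hle _ hy)]
  simp

/-- The outgoing and the incoming darts give two parts of equal norm, and the triangle inequality
yields the factor `2²`. -/
theorem norm_sq_edgeVector_le (hτ : I.maxTime ≤ τ) {ε : ℂ} (hε : ‖ε‖ = 1)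
    (a : Fin n → ℕ → ℂ) : ‖edgeVector I τ K ε a‖ ^ 2 ≤
      4 * ∑ i, ∑ s ∈ Finset.range (I.time i), ‖a i s‖ ^ 2 := by
  have h : edgeVector I τ K ε a =
      (∑ i, ∑ s ∈ Finset.range (I.time i),
        a i s • pathState I τ i (s + 0) false (Sum.inr true, false)) +
      ε • ∑ i, ∑ s ∈ Finset.range (I.time i),
        a i s • pathState I τ i (s + 1) false (Sum.inr false, false) := by
    simp only [edgeVector, smul_add, Finset.sum_add_distrib, Finset.smul_sum, add_zero]
    congr 1
    exact Finset.sum_congr rfl fun i _ => Finset.sum_congr rfl fun s _ => smul_comm _ _ _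
  have h1 := norm_sq_sum_pathState (K := K) hτ a (Nat.zero_le 1) (Sum.inr true, false)
  have h2 := norm_sq_sum_pathState (K := K) hτ a le_rfl (Sum.inr false, false)
  rw [h]
  have h3 := norm_add_le (∑ i, ∑ s ∈ Finset.range (I.time i),
      a i s • pathState (K := K) I τ i (s + 0) false (Sum.inr true, false))
    (ε • ∑ i, ∑ s ∈ Finset.range (I.time i),
      a i s • pathState (K := K) I τ i (s + 1) false (Sum.inr false, false))
  rw [norm_smul, hε, one_mul] at h3
  have h4 := pow_le_pow_left₀ (norm_nonneg _) h3 2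
  refine h4.trans ?_
  rw [← h1] at h2 ⊢
  rw [(sq_eq_sq₀ (norm_nonneg _) (norm_nonneg _)).1 h2]
  apply le_of_eq
  ring

/-- A linear isometry that fixes `u`, and acts on `v` as `ε` up to a small catalyst. -/
theorem norm_inner_return_sub_le {E : Type*} [NormedAddCommGroup E] [InnerProductSpace ℂ E]
    (W : E →ₗᵢ[ℂ] E) {u v ζ : E} {ε : ℂ} (hu : ‖u‖ = 1) (hv : ‖v‖ = 1)
    (huv : inner ℂ u v = (0 : ℂ)) (hWu : W u = u) (hWv : W (v + ζ) = ε • v + ζ) :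
    ‖inner ℂ (((Real.sqrt 2)⁻¹ : ℝ) • (u + v)) (W (((Real.sqrt 2)⁻¹ : ℝ) • (u + v))) -
      (1 + ε) / 2‖ ≤ 2 * ‖ζ‖ := by
  -- Omitting the catalyst leaves the error `ζ - W ζ`, of norm at most `2‖ζ‖`.
  have h1 : W (u + v) = u + ε • v + (ζ - W ζ) := by
    rw [map_add] at hWv
    rw [map_add, hWu, eq_sub_of_add_eq hWv]
    abel
  have hvu : inner ℂ v u = (0 : ℂ) := inner_eq_zero_symm.1 huv
  have hs : (((Real.sqrt 2)⁻¹ : ℝ) : ℂ) * (((Real.sqrt 2)⁻¹ : ℝ) : ℂ) = 1 / 2 := by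
    rw [← Complex.ofReal_mul, ← mul_inv, Real.mul_self_sqrt (by norm_num)]
    push_cast
    norm_num
  have h2 : inner ℂ (((Real.sqrt 2)⁻¹ : ℝ) • (u + v)) (W (((Real.sqrt 2)⁻¹ : ℝ) • (u + v))) -
      (1 + ε) / 2 = 1 / 2 * inner ℂ (u + v) (ζ - W ζ) := by
    rw [← Complex.coe_smul, map_smul, inner_smul_left, inner_smul_right, Complex.conj_ofReal,
      ← mul_assoc, hs, h1, inner_add_right, inner_add_right, inner_smul_right, inner_add_left,
      inner_add_left, huv, hvu, inner_self_eq_norm_sq_to_K, inner_self_eq_norm_sq_to_K, hu, hv]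
    push_cast
    ring
  rw [h2, norm_mul]
  have h3 : ‖u + v‖ ≤ 2 := (norm_add_le _ _).trans (by rw [hu, hv]; norm_num)
  have h4 : ‖ζ - W ζ‖ ≤ 2 * ‖ζ‖ := (norm_sub_le _ _).trans (by rw [W.norm_map]; linarith)
  have h5 := (norm_inner_le_norm (𝕜 := ℂ) (u + v) (ζ - W ζ)).trans
    (mul_le_mul h3 h4 (norm_nonneg _) (by norm_num))
  have h6 : ‖(1 / 2 : ℂ)‖ = 1 / 2 := by norm_num
  rw [h6]
  linarith

/-! ### Superposition over the slots of the clock -/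

theorem inner_slotState (k k' : Option (Fin K)) :
    inner ℂ (slotState n d τ k) (slotState n d τ k') = if k = k' then (1 : ℂ) else 0 := by
  simp [slotState, basisState, EuclideanSpace.inner_single_left]

theorem runCircuit_flatMap_of_not_mem (O : I.Oracles τ) (r : ℝ) (l : List (Fin K))
    {k : Option (Fin K)} (hk : ∀ j ∈ l, k ≠ some j) :
    runCircuit O (l.flatMap (walkStages r)) (slotState n d τ k) = slotState n d τ k := by
  induction l with
  | nil => rfl
  | cons j l ih =>
    rw [List.flatMap_cons, runCircuit_append, walk_slot O r (hk j (by simp)),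
      ih fun j hj => hk j (by simp [hj])]

/-- Iteration `j` multiplies slot `j` by `ε`, leaves the other slots idle and hands `Ω` on to the
next iteration. One catalyst thus serves all slots; since the list has no repetitions, each slot is
turned once. -/
theorem runCircuit_flatMap_of_mem (O : I.Oracles τ) (r : ℝ) {c ε : ℂ}
    {Ω : Amplitudes (Memory n d τ (labelDim K))}
    (hΩ : ∀ j, runCircuit O (walkStages r j) (c • slotState n d τ (some j) + Ω) =
      ε • c • slotState n d τ (some j) + Ω) (l : List (Fin K)) (hl : l.Nodup) :
    runCircuit O (l.flatMap (walkStages r))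
        (c • (l.map fun j => slotState n d τ (some j)).sum + Ω) =
      ε • c • (l.map fun j => slotState n d τ (some j)).sum + Ω := by
  induction l with
  | nil => simp [runCircuit_nil]
  | cons j l ih =>
    rw [List.nodup_cons] at hl
    have hrest : runCircuit O (walkStages r j)
        (l.map fun k => slotState n d τ (some k)).sum =
        (l.map fun k => slotState n d τ (some k)).sum := by
      rw [map_list_sum, List.map_map]
      congr 1
      refine List.map_congr_left fun k hk => walk_slot O r ?_
      intro h
      exact hl.1 (Option.some_injective _ h ▸ hk)
    have hj : runCircuit O (l.flatMap (walkStages r)) (slotState n d τ (some j)) =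
        slotState n d τ (some j) := by
      refine runCircuit_flatMap_of_not_mem O r l fun k hk h => ?_
      exact hl.1 (Option.some_injective _ h ▸ hk)
    have h1 : c • ((j :: l).map fun j => slotState n d τ (some j)).sum + Ω =
        (c • slotState n d τ (some j) + Ω) +
          c • (l.map fun k => slotState n d τ (some k)).sum := by
      rw [List.map_cons, List.sum_cons, smul_add]
      abel
    rw [h1, List.flatMap_cons, runCircuit_append, map_add, hΩ, map_smul, hrest]
    have h2 : ε • c • slotState n d τ (some j) + Ω +
        c • (l.map fun k => slotState n d τ (some k)).sum =
        ε • c • slotState n d τ (some j) +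
          (c • (l.map fun k => slotState n d τ (some k)).sum + Ω) := by abel
    rw [h2, map_add, ih hl.2, map_smul, map_smul, hj, List.map_cons, List.sum_cons]
    simp only [smul_add]
    abel

/-- The uniform superposition of the slots of the clock, without the reference. -/
noncomputable def clockState (n d τ K : ℕ) [NeZero n] [NeZero d] :
    Amplitudes (Memory n d τ (labelDim K)) :=
  (((Real.sqrt K)⁻¹ : ℝ) : ℂ) • ∑ k : Fin K, slotState n d τ (some k)

/-- The initial state of the walk. -/
noncomputable def walkStart (n d τ K : ℕ) [NeZero n] [NeZero d] :
    Amplitudes (Memory n d τ (labelDim K)) :=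
  ((Real.sqrt 2)⁻¹ : ℝ) • (slotState n d τ none + clockState n d τ K)

theorem norm_slotState (k : Option (Fin K)) : ‖slotState n d τ k‖ = 1 := by
  have h := inner_slotState (n := n) (d := d) (τ := τ) k k
  rw [if_pos rfl, inner_self_eq_norm_sq_to_K] at h
  have h' : ((‖slotState n d τ k‖ : ℝ) : ℂ) ^ 2 = 1 := h
  exact (pow_eq_one_iff_of_nonneg (norm_nonneg _) two_ne_zero).1 (by exact_mod_cast h')

theorem norm_clockState (hK : 0 < K) : ‖clockState n d τ K‖ = 1 := by
  have h := norm_sq_sum_smul_of_orthonormal Finset.univ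
    (fun k : Fin K => slotState n d τ (some k)) (fun _ => 1) fun x _ y _ => by
      simp [inner_slotState]
  simp only [one_smul, norm_one, one_pow, Finset.sum_const, Finset.card_univ, Fintype.card_fin,
    nsmul_eq_mul, mul_one] at h
  have hK' : (0 : ℝ) < Real.sqrt K := Real.sqrt_pos.2 (by exact_mod_cast hK)
  rw [clockState, norm_smul, Complex.norm_real, Real.norm_of_nonneg (by positivity),
    ← Real.sqrt_sq (norm_nonneg (∑ k : Fin K, _)), h, inv_mul_cancel₀ hK'.ne']

theorem inner_slotState_clockState :
    inner ℂ (slotState n d τ none) (clockState n d τ K) = (0 : ℂ) := by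
  rw [clockState, inner_smul_right, inner_sum]
  simp [inner_slotState]

theorem norm_walkStart (hK : 0 < K) : ‖walkStart n d τ K‖ = 1 := by
  have h := norm_add_sq (𝕜 := ℂ) (slotState n d τ none) (clockState n d τ K)
  rw [inner_slotState_clockState, norm_slotState, norm_clockState hK] at h
  have h' : ‖slotState n d τ none + clockState n d τ K‖ ^ 2 = 2 := by
    rw [h]; norm_num
  rw [walkStart, norm_smul, Real.norm_of_nonneg (by positivity),
    ← Real.sqrt_sq (norm_nonneg (slotState n d τ none + _)), h',
    inv_mul_cancel₀ (by positivity)]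

/-- Normalising the clock scales the catalyst to `Ω / (c√K)`, of norm at most `1/20` by `hΩn`; the
error is at most twice that. -/
theorem norm_inner_walk_sub_le (O : I.Oracles τ) (hK : 0 < K) (r : ℝ) {c : ℝ} (hc : 0 < c)
    {ε : ℂ} {Ω : Amplitudes (Memory n d τ (labelDim K))}
    (hΩ : ∀ j, runCircuit O (walkStages r j) ((c : ℂ) • slotState n d τ (some j) + Ω) =
      ε • (c : ℂ) • slotState n d τ (some j) + Ω) (hΩn : 400 * ‖Ω‖ ^ 2 ≤ c ^ 2 * K) :
    ‖inner ℂ (walkStart n d τ K)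
        (runCircuit O ((List.finRange K).flatMap (walkStages r)) (walkStart n d τ K)) -
      (1 + ε) / 2‖ ≤ 1 / 10 := by
  have hK' : (0 : ℝ) < Real.sqrt K := Real.sqrt_pos.2 (by exact_mod_cast hK)
  have hsum : ((List.finRange K).map fun j => slotState n d τ (some j)).sum =
      ∑ k : Fin K, slotState n d τ (some k) := by
    rw [Fin.sum_univ_def]
  have hrun := runCircuit_flatMap_of_mem O r hΩ (List.finRange K) (List.nodup_finRange K)
  rw [hsum] at hrun
  set β : ℂ := (((c * Real.sqrt K)⁻¹ : ℝ) : ℂ) with hβ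
  have hβc : (((Real.sqrt K)⁻¹ : ℝ) : ℂ) = β * c := by
    rw [hβ, ← Complex.ofReal_mul]
    congr 1
    field_simp
  have hcat : runCircuit O ((List.finRange K).flatMap (walkStages r))
      (clockState n d τ K + β • Ω) = ε • clockState n d τ K + β • Ω := by
    rw [clockState, hβc, mul_smul, ← smul_add, map_smul, hrun, smul_add, smul_comm ε β]
  have hmain := norm_inner_return_sub_le _ (norm_slotState none) (norm_clockState hK)
    inner_slotState_clockState (runCircuit_flatMap_of_not_mem O r (List.finRange K) (by simp)) hcat
  refine hmain.trans ?_
  have hn : ‖β • Ω‖ ≤ 1 / 20 := by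
    rw [norm_smul, hβ, Complex.norm_real, Real.norm_of_nonneg (by positivity), inv_mul_le_iff₀
      (by positivity)]
    refine le_of_sq_le_sq ?_ (by positivity)
    rw [mul_pow, mul_pow, Real.sq_sqrt (Nat.cast_nonneg K)]
    linarith
  linarith

end Walk

/-! ### Choice of parameters and query count -/

section Search

/-- The upper bound `1 + log t` for the resistance of a path of length `t`. -/
noncomputable def pathResistance (t : ℕ) : ℝ := 1 + Real.log t

/-- The geometric mean of total weight and resistance. -/
noncomputable def searchCost (T t : ℕ) : ℝ := Real.sqrt (T * pathResistance t)

/-- The number of iterations of the walk. -/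
noncomputable def searchLength (T t : ℕ) : ℕ := ⌈1600 * searchCost T t⌉₊ + 1

/-- The square root of the weight of the edge between the clock and the root. -/
noncomputable def clockWeight (T t : ℕ) : ℝ := Real.sqrt (searchCost T t / pathResistance t)

/-- An isometry that prepares the initial state of the walk. -/
noncomputable def walkPrep (n d τ K : ℕ) [NeZero n] [NeZero d] (hK : 0 < K) :
    Amplitudes (Memory n d τ (labelDim K)) ≃ₗᵢ[ℂ] Amplitudes (Memory n d τ (labelDim K)) :=
  (exists_isometry_single_eq (false, 0, 0, 0, false, 0) (walkStart n d τ K)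
    (norm_walkStart hK)).choose

/-- The variable time search algorithm. -/
noncomputable def variableTimeSearch (n d : ℕ) [NeZero n] [NeZero d] (T t : ℕ) :
    QueryAlgorithm n d t :=
  returnTest (walkPrep n d t (searchLength T t) (Nat.succ_pos _))
    ((List.finRange (searchLength T t)).flatMap (walkStages (clockWeight T t)))

theorem numQueries_variableTimeSearch (n d : ℕ) [NeZero n] [NeZero d] (T t : ℕ) :
    (variableTimeSearch n d T t).numQueries = 8 * searchLength T t := by
  rw [QueryAlgorithm.numQueries, variableTimeSearch, returnTest]
  simp [length_circuitRounds, List.length_flatMap, length_walkStages, mul_comm]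

variable {n d : ℕ} [NeZero n] [NeZero d] {I : VTSInput n d}

theorem one_le_pathResistance (t : ℕ) : 1 ≤ pathResistance t :=
  le_add_of_nonneg_right (Real.log_natCast_nonneg t)

theorem sum_inv_le_pathResistance {s t : ℕ} (hs : 0 < s) (h : s ≤ t) :
    ∑ i ∈ Finset.range s, ((i : ℝ) + 1)⁻¹ ≤ pathResistance t := by
  have h1 := harmonic_le_one_add_log s
  rw [harmonic] at h1
  push_cast at h1
  refine h1.trans (add_le_add_right (Real.log_le_log (by exact_mod_cast hs) (by exact_mod_cast h)) 1)

theorem sum_succ_le_sq (t : ℕ) : ∑ s ∈ Finset.range t, ((s : ℝ) + 1) ≤ (t : ℝ) ^ 2 := by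
  have h : ∑ s ∈ Finset.range t, ((s : ℝ) + 1) ≤ ∑ _s ∈ Finset.range t, (t : ℝ) := by
    refine Finset.sum_le_sum fun s hs => ?_
    exact_mod_cast Finset.mem_range.1 hs
  refine h.trans (le_of_eq ?_)
  simp [sq]

theorem norm_sq_potential_le {τ K : ℕ} (hτ : I.maxTime ≤ τ) :
    ‖edgeVector I τ K (-1) potentialCoeff‖ ^ 2 ≤ 4 * (I.sumSq : ℝ) := by
  refine (norm_sq_edgeVector_le hτ (by simp) _).trans ?_
  rw [VTSInput.sumSq]
  push_cast
  refine mul_le_mul_of_nonneg_left (Finset.sum_le_sum fun i _ => ?_) (by norm_num)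
  refine le_trans (le_of_eq ?_) (sum_succ_le_sq (I.time i))
  refine Finset.sum_congr rfl fun s _ => ?_
  rw [potentialCoeff, Complex.norm_real, Real.norm_of_nonneg (Real.sqrt_nonneg _),
    Real.sq_sqrt (by positivity)]

theorem norm_sq_flow_le {τ K : ℕ} (hτ : I.maxTime ≤ τ) (r : ℝ) (i₀ : Fin n) :
    ‖edgeVector I τ K 1 (flowCoeff r i₀)‖ ^ 2 ≤ 4 * (r ^ 2 * pathResistance τ) := by
  refine (norm_sq_edgeVector_le hτ (by simp) _).trans ?_
  refine mul_le_mul_of_nonneg_left ?_ (by norm_num)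
  rw [Finset.sum_eq_single i₀]
  · refine le_trans (le_of_eq ?_) (mul_le_mul_of_nonneg_left (sum_inv_le_pathResistance
      (time_pos I i₀) ((time_le_maxTime I i₀).trans hτ)) (sq_nonneg r))
    rw [Finset.mul_sum]
    refine Finset.sum_congr rfl fun s _ => ?_
    rw [flowCoeff, if_pos rfl, Complex.norm_real, Real.norm_eq_abs, sq_abs, div_pow,
      Real.sq_sqrt (by positivity), neg_sq, div_eq_mul_inv]
  · intro i _ hi
    simp [flowCoeff, hi]
  · simp

theorem one_le_sumSq (I : VTSInput n d) : 1 ≤ I.sumSq := by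
  have h1 : 1 ≤ I.time 0 ^ 2 := Nat.one_le_pow _ _ (time_pos I 0)
  exact h1.trans (Finset.single_le_sum (f := fun i => I.time i ^ 2) (fun _ _ => Nat.zero_le _)
    (Finset.mem_univ 0))

theorem one_le_searchCost {T t : ℕ} (hT : 1 ≤ T) : 1 ≤ searchCost T t := by
  rw [searchCost, Real.one_le_sqrt]
  exact one_le_mul_of_one_le_of_one_le (by exact_mod_cast hT) (one_le_pathResistance t)

theorem le_searchLength (T t : ℕ) : 1600 * searchCost T t ≤ searchLength T t := by
  rw [searchLength]
  push_cast
  linarith [Nat.le_ceil (1600 * searchCost T t)]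

/-- With `q = √(T R)`, `r² = q / R` and `K ≥ 1600 q`, the flow needs `400 · 4 r² R = 1600 q ≤ K`,
and the potential needs `400 · 4 T = r² · 1600 q ≤ r² K`. The return amplitude is then within `1/10`
of `1` or `0`, so the probability is at least `0.81` or at most `0.01`. -/
theorem variableTimeSearch_detects {T t : ℕ} (O : I.Oracles t) (hT : I.sumSq ≤ T)
    (ht : I.maxTime ≤ t) : (variableTimeSearch n d T t).Detects O := by
  have hprep := (exists_isometry_single_eq (false, 0, 0, 0, false, 0)
    (walkStart n d t (searchLength T t)) (norm_walkStart (Nat.succ_pos _))).choose_spec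
  have hacc := acceptProb_returnTest O (walkPrep n d t (searchLength T t) (Nat.succ_pos _))
    ((List.finRange (searchLength T t)).flatMap (walkStages (clockWeight T t))) _ hprep
  have hL := one_le_pathResistance t
  have hq := one_le_searchCost (t := t) ((one_le_sumSq I).trans hT)
  have hK := le_searchLength T t
  have hsq : searchCost T t ^ 2 = T * pathResistance t := by
    rw [searchCost, Real.sq_sqrt (by positivity)]
  have hr : clockWeight T t ^ 2 = searchCost T t / pathResistance t := by
    rw [clockWeight, Real.sq_sqrt (by positivity)]
  have hr0 : 0 < clockWeight T t := Real.sqrt_pos.2 (by positivity)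
  have hT' : (I.sumSq : ℝ) ≤ T := by exact_mod_cast hT
  rw [QueryAlgorithm.Detects, variableTimeSearch, hacc]
  constructor
  · rintro ⟨i₀, hx⟩
    have h := norm_inner_walk_sub_le O (Nat.succ_pos _) (clockWeight T t) one_pos (ε := 1)
      (K := searchLength T t)
      (Ω := edgeVector I t _ 1 (flowCoeff (clockWeight T t) i₀))
      (fun j => by simpa using walk_flow O ht hx (clockWeight T t) j) (by
        have h1 := norm_sq_flow_le (K := searchLength T t) ht (clockWeight T t) i₀
        rw [hr, div_mul_cancel₀ _ (by positivity)] at h1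
        linarith)
    have h9 : ((1 + 1) / 2 : ℂ) = 1 := by norm_num
    rw [h9] at h
    have h2 := norm_sub_norm_le (1 : ℂ) (inner ℂ (walkStart n d t (searchLength T t))
      (runCircuit O ((List.finRange (searchLength T t)).flatMap (walkStages (clockWeight T t)))
        (walkStart n d t (searchLength T t))))
    rw [norm_sub_rev, norm_one] at h2
    nlinarith
  · intro hx
    have hx' : ∀ i, I.x i = false := by
      intro i
      by_contra h
      exact hx ⟨i, by simpa using h⟩
    have h := norm_inner_walk_sub_le O (Nat.succ_pos _) (clockWeight T t) hr0 (ε := -1)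
      (K := searchLength T t) (Ω := edgeVector I t _ (-1) potentialCoeff)
      (fun j => walk_potential O ht hx' (clockWeight T t) j) (by
        have h1 := norm_sq_potential_le (I := I) (K := searchLength T t) ht
        have h2 : 1600 * (T : ℝ) ≤ clockWeight T t ^ 2 * searchLength T t := by
          rw [hr]
          refine le_trans (le_of_eq ?_) (mul_le_mul_of_nonneg_left hK (by positivity))
          rw [div_mul_eq_mul_div, eq_div_iff (by positivity)]
          linear_combination (-1600) * hsq
        linarith)
    have h9 : ((1 + -1) / 2 : ℂ) = 0 := by norm_num
    rw [h9, sub_zero] at h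
    have h0 := norm_nonneg (inner ℂ (walkStart n d t (searchLength T t))
      (runCircuit O ((List.finRange (searchLength T t)).flatMap (walkStages (clockWeight T t)))
        (walkStart n d t (searchLength T t))))
    nlinarith

/-- The additive constants are absorbed because `m ≥ 1` gives `log (m + 1) ≥ log 2`; positivity of
`c` is forced by `t ≥ 1`. -/
theorem pathResistance_le {t m k : ℕ} {c : ℝ} (ht : 1 ≤ t) (hm : 1 ≤ m)
    (h : (t : ℝ) ≤ c * (m : ℝ) ^ k) :
    pathResistance t ≤ ((1 + |Real.log c|) / Real.log 2 + k) * Real.log ((m : ℝ) + 1) := by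
  have hm' : (1 : ℝ) ≤ m := by exact_mod_cast hm
  have ht' : (1 : ℝ) ≤ t := by exact_mod_cast ht
  have hmk : (0 : ℝ) < (m : ℝ) ^ k := by positivity
  have hc : 0 < c := by
    by_contra hc
    have := mul_nonpos_of_nonpos_of_nonneg (not_lt.1 hc) hmk.le
    linarith
  have h1 : Real.log t ≤ Real.log c + k * Real.log m := by
    rw [← Real.log_pow, ← Real.log_mul hc.ne' hmk.ne']
    exact Real.log_le_log (by linarith) h
  have h2 : Real.log m ≤ Real.log ((m : ℝ) + 1) := Real.log_le_log (by linarith) (by linarith)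
  have h3 : Real.log 2 ≤ Real.log ((m : ℝ) + 1) := Real.log_le_log (by norm_num) (by linarith)
  have h4 : 0 < Real.log 2 := Real.log_pos (by norm_num)
  have h5 : 1 + |Real.log c| ≤ (1 + |Real.log c|) / Real.log 2 * Real.log ((m : ℝ) + 1) := by
    rw [div_mul_eq_mul_div, le_div_iff₀ h4]
    exact mul_le_mul_of_nonneg_left h3 (by positivity)
  have h6 : (k : ℝ) * Real.log m ≤ k * Real.log ((m : ℝ) + 1) :=
    mul_le_mul_of_nonneg_left h2 (Nat.cast_nonneg k)
  rw [pathResistance, add_mul]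
  linarith [le_abs_self (Real.log c)]

/-- The count `8(⌈1600 q⌉ + 1)` is at most `12800 q + 16`, and `q ≥ 1`. -/
theorem numQueries_variableTimeSearch_le {T t : ℕ} (hT : 1 ≤ T) :
    ((variableTimeSearch n d T t).numQueries : ℝ) ≤ 12816 * searchCost T t := by
  have hq := one_le_searchCost (t := t) hT
  have h := Nat.ceil_lt_add_one (a := 1600 * searchCost T t) (by positivity)
  rw [numQueries_variableTimeSearch, searchLength]
  push_cast
  linarith

end Search

/-! ### The main theorem -/

theorem mainTheorem4 :
    ∃ alg : ∀ (n d : ℕ) [NeZero n] [NeZero d] (T' t' : ℕ), QueryAlgorithm n d t',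
      (∀ (n d : ℕ) [NeZero n] [NeZero d] (T' t' : ℕ) (I : VTSInput n d) (O : I.Oracles t'),
        I.sumSq ≤ T' → I.maxTime ≤ t' → (alg n d T' t').Detects O) ∧
      (∀ (a c : ℝ) (k : ℕ), ∃ C : ℝ,
        ∀ (n d : ℕ) [NeZero n] [NeZero d] (T' t' : ℕ) (I : VTSInput n d),
          I.sumSq ≤ T' → (T' : ℝ) ≤ a * (I.sumSq : ℝ) →
          I.maxTime ≤ t' → (t' : ℝ) ≤ c * (I.maxTime : ℝ) ^ k →
          ((alg n d T' t').numQueries : ℝ) ≤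
            C * Real.sqrt ((I.sumSq : ℝ) * Real.log ((I.maxTime : ℝ) + 1))) := by
  refine ⟨fun n d _ _ T t => variableTimeSearch n d T t,
    fun n d _ _ T t I O hT ht => variableTimeSearch_detects O hT ht, fun a c k =>
    ⟨12816 * Real.sqrt (a * ((1 + |Real.log c|) / Real.log 2 + k)), ?_⟩⟩
  intro n d _ _ T t I hT hTa ht htc
  have hI := one_le_sumSq I
  have hm : 1 ≤ I.maxTime := (time_pos I 0).trans_le (time_le_maxTime I 0)
  have hR := pathResistance_le (hm.trans ht) hm htc
  refine (numQueries_variableTimeSearch_le (hI.trans hT)).trans ?_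
  have h4 : 0 < Real.log 2 := Real.log_pos (by norm_num)
  have hM : 0 ≤ (1 + |Real.log c|) / Real.log 2 + k := by positivity
  have hI' : (1 : ℝ) ≤ I.sumSq := by exact_mod_cast hI
  have hT' : (0 : ℝ) ≤ T := Nat.cast_nonneg T
  -- A negative `a` would make `T'` negative, while `T' ≥ 1`.
  have ha : 0 ≤ a := by
    by_contra ha
    have h1 : (1 : ℝ) ≤ T := by exact_mod_cast hI.trans hT
    nlinarith
  rw [mul_assoc, ← Real.sqrt_mul (mul_nonneg ha hM), searchCost]
  refine mul_le_mul_of_nonneg_left (Real.sqrt_le_sqrt ?_) (by norm_num)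
  refine (mul_le_mul hTa hR (by linarith [one_le_pathResistance t]) (by positivity)).trans
    (le_of_eq (by ring))
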